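/- Let $0<p_2<p_1<1$, $\gamma_1,\gamma_2>0$ with $\gamma_1+\gamma_2=1$, and let $\alpha<1$ satisfy $$\alpha>\frac{1}{1+(D-2)p_2},\qquad D=\frac{1}{p_1-p_2}\Big(\frac{p_1+p_2}{2}+\sqrt{2(p_1-p_2)+\tfrac{(p_1+p_2)^2}{4}}\Big).$$ A state is a family $z=(z_i^k)_{k\in\{1,2\},\,i\ge 1}$ of nonnegative reals with $\sum_{i\ge1}z^k_i=\gamma_k$ ($z_i^k$ is the proportion of users that belong to class $k$ and have age $i$). Given scheduled masses $0\le s_i^k\le z_i^k$, the next state $z'$ is $$z'^{\,k}_1=p_k\sum_{i\ge1}s^k_i,\qquad z'^{\,k}_{i+1}=z_i^k-p_ks_i^k\quad(i\ge1).$$ The Whittle index of age $i$ in class $k$ is $W^k(i)=\frac{(i-1)p_ki}{2}+i$. Write $(k,i)\prec(m,j)$ if $W^k(i)<W^m(j)$ or $(k,i)=(2,1)$, $(m,j)=(1,1)$; thus the tie $W^1(1)=W^2(1)$ is resolved in favour of class 1. A Whittle schedule for $z$ is a family $s$ with $0\le s\le z$, $\sum_{k,i}s_i^k=\alpha$, and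 $s^m_j=z^m_j$ whenever $(k,i)\prec(m,j)$ and $s^k_i>0$ (all other ties are broken arbitrarily). A fluid trajectory is a sequence of states $z(t)$, $t\ge0$, with Whittle schedules $s(t)$ for $z(t)$, such that $z(t+1)$ is the next state of $z(t)$ under $s(t)$; $z(0)$ is an arbitrary state. Put $\alpha_k(t)=\sum_i s_i^k(t)$. Let $u^n_k(i)=(1-p_k)^{\max(i-n,0)}\frac{p_k}{np_k+1-p_k}$ be the stationary law of the age in class $k$ under the threshold $n$. For a class $m$ and an age $n\ge1$ let $l_k^1-1$ be the largest $i\ge1$ with not $(m,n)\prec(k,i)$, and $l^2_k-1$ the largest $i\ge1$ with $(k,i)\prec(m,n)$ (each $0$ if there is none). Let $z^*$ be given by $$z_i^{k,*}=\gamma_k\big(\theta u_k^{l^1_k}(i)+(1-\theta)u_k^{l_k^2}(i)\big),\qquad 0<\theta\le1,$$ where $(m,n)$ and $\theta$ are such that $\theta\sum_k\gamma_k\sum_{i\ge l_k^1}u_k^{l_k^1}(i)+(1-\theta)\sum_k\gamma_k\sum_{i\ge l_k^2}u_k^{l_k^2}(i)=\alpha$. Then: 1. Exactly one family $z^*$ is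 obtained in this way. 2. $z^*$ solves the relaxed problem: some $s^*$ with $0\le s^*\le z^*$ and $\sum_{k,i} s_i^{k,*}\le\alpha$ keeps $z^*$ stationary, and $$\sum_{k,i}i\,z_i^{k,*}\le\limsup_{T\to\infty}\frac1T\sum_{t<T}\sum_{k,i}i\,y_i^k(t)$$ for all sequences of states $y(t)$ and of masses $0\le s(t)\le y(t)$ such that $y(t+1)$ is the next state of $y(t)$ under $s(t)$ and $\limsup_{T}\frac1T\sum_{t<T}\sum_{k,i}s_i^k(t)\le\alpha$. 3. $z^*$ is the unique fixed point of the fluid dynamics: a state $z$ is its own next state under some Whittle schedule for $z$ if and only if $z=z^*$. 4. There are $\alpha_1^*,\alpha_2^*$ with $\alpha_1^*+\alpha_2^*=\alpha$ such that for every fluid trajectory, from any initial state, $\alpha_k(t)\to\alpha_k^*$ and $z_i^k(t)\to z_i^{k,*}$ as $t\to\infty$, for $k=1,2$ and all $i\ge1$. -/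

import Mathlib

open Filter Topology
open scoped BigOperators ENNReal

noncomputable section

namespace AgeFluid

/-- The two classes of users are indexed by `Fin 2`: index `0` is class 1 and index `1` is class 2.
For `z : Profile`, `z k i` is a proportion (relative to the whole population) of users of class `k`
with age `i`. Ages are the integers `i ≥ 1`; the slot `i = 0` is unused and carries mass `0`. -/
abbrev Profile := Fin 2 → ℕ → ℝ

/-- A state: a nonnegative profile with total mass `γ k` in class `k`. -/
def IsState (γ : Fin 2 → ℝ) (z : Profile) : Prop :=
  ∀ k, z k 0 = 0 ∧ (∀ i, 0 ≤ z k i) ∧ HasSum (z k) (γ k)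

/-- `s k i` is the part of the mass `z k i` that is scheduled for transmission. -/
def IsAdmissible (z s : Profile) : Prop :=
  ∀ k i, 0 ≤ s k i ∧ s k i ≤ z k i

/-- The scheduled proportion of class `k`. -/
def scheduled (s : Profile) (k : Fin 2) : ℝ := ∑' i, s k i

/-- One slot of the mean dynamics: a scheduled user of class `k` succeeds with probability `p k`
and then has age `1`; every other user grows older by one slot. -/
def next (p : Fin 2 → ℝ) (z s : Profile) : Profile
  | _, 0 => 0
  | k, 1 => p k * scheduled s k
  | k, i + 2 => z k (i + 1) - p k * s k (i + 1)

/-- Whittle's index of age `i` for success probability `q`. -/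
def whittleIndex (q : ℝ) (i : ℕ) : ℝ := ((i : ℝ) - 1) * q * i / 2 + i

/-- Users of class `k` and age `i` have strictly lower priority than users of class `m` and age `j`:
their Whittle index is smaller, or both pairs are at age `1` (where the indices of the two classes
coincide), `k` is class 2 and `m` is class 1. -/
def LowerPriority (p : Fin 2 → ℝ) (k : Fin 2) (i : ℕ) (m : Fin 2) (j : ℕ) : Prop :=
  whittleIndex (p k) i < whittleIndex (p m) j ∨ (i = 1 ∧ j = 1 ∧ k = 1 ∧ m = 0)

/-- `s` schedules a proportion `α` of users with the highest Whittle indices: if some mass of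
lower priority is scheduled, then all mass of higher priority is. Apart from age `1`, ties are
broken arbitrarily. -/
def IsWhittleSchedule (p : Fin 2 → ℝ) (α : ℝ) (z s : Profile) : Prop :=
  IsAdmissible z s ∧ ∑ k, scheduled s k = α ∧
    ∀ k i m j, 1 ≤ i → 1 ≤ j → LowerPriority p k i m j → 0 < s k i → s m j = z m j

/-- `z t` is a fluid trajectory under Whittle's index policy, `s t` being the scheduled masses. -/
def IsFluidTrajectory (p γ : Fin 2 → ℝ) (α : ℝ) (z s : ℕ → Profile) : Prop :=
  IsState γ (z 0) ∧
    ∀ t, IsWhittleSchedule p α (z t) (s t) ∧ z (t + 1) = next p (z t) (s t)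

/-- A fixed point of the fluid dynamics under Whittle's index policy. -/
def IsFixedPoint (p γ : Fin 2 → ℝ) (α : ℝ) (z : Profile) : Prop :=
  IsState γ z ∧ ∃ s, IsWhittleSchedule p α z s ∧ next p z s = z

/-- Stationary law of the age of a user with success probability `q` that is scheduled exactly when
its age is at least `n`. -/
def stationaryAge (q : ℝ) (n i : ℕ) : ℝ :=
  if i = 0 then 0 else (1 - q) ^ (i - n) * (q / (n * q + 1 - q))

/-- Stationary scheduled proportion when class `k` uses the threshold `l k`. -/
def thresholdLoad (p γ : Fin 2 → ℝ) (l : Fin 2 → ℕ) : ℝ :=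
  ∑ k, γ k * ∑' i, stationaryAge (p k) (l k) (l k + i)

/-- The profile `z*` of the relaxed problem: the mixture, with weights `θ` and `1 - θ`, of two
threshold policies. For a pair `(m, n)` of a class and an age, `l₁ k - 1` is the largest age of
class `k` whose priority is not above that of `(m, n)`, and `l₂ k - 1` the largest one (`0` if there
is none) whose priority is strictly below; the mixture schedules exactly the proportion `α`. -/
def IsThresholdMixture (p γ : Fin 2 → ℝ) (α : ℝ) (z : Profile) : Prop :=
  ∃ (m : Fin 2) (n : ℕ) (l₁ l₂ : Fin 2 → ℕ) (θ : ℝ),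
    1 ≤ n ∧ (∀ k, 1 ≤ l₁ k ∧ 1 ≤ l₂ k) ∧
    (∀ k i, 1 ≤ i → (i < l₁ k ↔ ¬ LowerPriority p m n k i)) ∧
    (∀ k i, 1 ≤ i → (i < l₂ k ↔ LowerPriority p k i m n)) ∧
    0 < θ ∧ θ ≤ 1 ∧
    θ * thresholdLoad p γ l₁ + (1 - θ) * thresholdLoad p γ l₂ = α ∧
    ∀ k i, z k i =
      γ k * (θ * stationaryAge (p k) (l₁ k) i + (1 - θ) * stationaryAge (p k) (l₂ k) i)

/-- Mean age per user. -/
def meanAge (z : Profile) : ℝ≥0∞ := ∑ k, ∑' i : ℕ, ENNReal.ofReal (i * z k i)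

/-- Long-run average age per user of a trajectory. -/
def averageAge (z : ℕ → Profile) : ℝ≥0∞ :=
  limsup (fun T : ℕ => (∑ t ∈ Finset.range T, meanAge (z t)) / (T : ℝ≥0∞)) atTop

/-- Trajectories of the relaxed problem. Under an arbitrary scheduling policy, the expected
proportions `z t` and the expected scheduled proportions `s t` follow the mean dynamics; the
scheduled proportion has to be at most `α` only on average over time. -/
def IsRelaxedFeasible (p γ : Fin 2 → ℝ) (α : ℝ) (z s : ℕ → Profile) : Prop :=
  IsState γ (z 0) ∧
    (∀ t, IsAdmissible (z t) (s t) ∧ z (t + 1) = next p (z t) (s t)) ∧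
    limsup (fun T : ℕ => (∑ t ∈ Finset.range T, ∑ k, scheduled (s t) k) / (T : ℝ)) atTop ≤ α

/-- The constant trajectory at `z` solves the relaxed problem: it is feasible, and no feasible
trajectory has a smaller long-run average age. -/
def IsRelaxedOptimum (p γ : Fin 2 → ℝ) (α : ℝ) (z : Profile) : Prop :=
  (∃ s : Profile, IsRelaxedFeasible p γ α (fun _ => z) (fun _ => s)) ∧
    ∀ y s : ℕ → Profile, IsRelaxedFeasible p γ α y s → averageAge (fun _ => z) ≤ averageAge y

/-- The constant `D` in the lower bound on `α`. -/
def alternationBound (p : Fin 2 → ℝ) : ℝ :=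
  1 / (p 0 - p 1) *
    ((p 0 + p 1) / 2 + √(2 * (p 0 - p 1) + (p 0 + p 1) ^ 2 / 4))

end AgeFluid

end

/-! The lower bound on `α` serves to produce an `n` with `1 - α < n * p 1 * α` such that the
priorities of the two classes alternate up to age `n + 1` (`exists_alternates`); on that range they
are ordered by `rank`. Users ranked below an idle mass have then been idle since age `1`. Idle mass
beyond age `n` would therefore force idle mass at least `p 1 * α` at each age `1, …, n`, more than
the available `1 - α`. So from slot `n` on, idle users have age at most `n` (`idle_eq_zero_of_lt`).

Now record idle masses as fractions of the cohort that returned to age `1` together. The fractions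
are threshold shaped in `rank`, so two such families are comparable, in the same direction for both
classes (`IsThresholdShaped.le_total`). Conservation of mass expresses the next scheduled proportion
of a class through its last `n + 1` values with nonnegative weights, of total at most `1` when the
fractions rise and at least `1` when they fall. In the first case an upper bound on a window
persists. In the second a lower bound for the other class persists, and the constant sum `α` turns
it into the same upper bound. The oscillation contracts and the proportions converge
(`exists_tendsto_of_window`). The limit is found by comparison with a stationary family:
comparability forces deviations of one sign in both classes, the constant sum forces opposite signs
(`tendsto_of_stationary`). Hence every trajectory converges to any given fixed point, and there is
at most one. Threshold mixtures are fixed points, and one exists by a discrete intermediate value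
argument.

Optimality is Lagrangian duality. Charging a transmission the Whittle index of `(m, n)` makes both
thresholds of the mixture optimal for a single user; a truncated relative value function turns the
Bellman inequality into a bound for all feasible trajectories (`IsRelaxedFeasible.le_averageAge`).
-/

namespace AgeFluid

/-! ### Order of the priorities -/

lemma whittleIndex_strictMono {q : ℝ} (hq : 0 < q) : StrictMono (whittleIndex q) := by
  refine strictMono_nat_of_lt_succ fun i => ?_
  have : 0 ≤ q * (i : ℝ) := by positivity
  simp only [whittleIndex]
  push_cast
  nlinarith

lemma whittleIndex_lt_whittleIndex {q r : ℝ} (hqr : q < r) {i : ℕ} (hi : 2 ≤ i) :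
    whittleIndex q i < whittleIndex r i := by
  have h2 : (2 : ℝ) ≤ i := by exact_mod_cast hi
  simp only [whittleIndex]
  have : 0 < ((i : ℝ) - 1) * i := by nlinarith
  nlinarith

lemma whittleIndex_one (q : ℝ) : whittleIndex q 1 = 1 := by simp [whittleIndex]

lemma LowerPriority.whittleIndex_le {p : Fin 2 → ℝ} {k m : Fin 2} {i j : ℕ}
    (h : LowerPriority p k i m j) : whittleIndex (p k) i ≤ whittleIndex (p m) j := by
  rcases h with h | ⟨rfl, rfl, rfl, rfl⟩
  · exact h.le
  · simp [whittleIndex_one]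

lemma LowerPriority.not_symm {p : Fin 2 → ℝ} {k m : Fin 2} {i j : ℕ}
    (h : LowerPriority p k i m j) : ¬ LowerPriority p m j k i := by
  rintro h'
  rcases h with h | ⟨rfl, rfl, rfl, rfl⟩
  · exact absurd h'.whittleIndex_le (not_le.2 h)
  · rcases h' with h' | ⟨_, _, h', _⟩
    · simp [whittleIndex_one] at h'
    · exact absurd h' (by decide)

/-- Negative transitivity of the priority order. Only the tie at index `1` is broken, and by strict
monotonicity only age `1` has an index that small. -/
lemma not_lowerPriority_of_not_of_lowerPriority {p : Fin 2 → ℝ} (hp : ∀ k, 0 < p k)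
    {k m m' : Fin 2} {i n j : ℕ} (hi : 1 ≤ i) (hn : 1 ≤ n)
    (h₁ : ¬ LowerPriority p k i m n) (h₂ : LowerPriority p k i m' j) :
    LowerPriority p m n m' j := by
  have h₃ : whittleIndex (p m) n ≤ whittleIndex (p k) i := by
    by_contra! h
    exact h₁ (Or.inl h)
  rcases h₂ with h₂ | ⟨rfl, rfl, rfl, rfl⟩
  · exact Or.inl (h₃.trans_lt h₂)
  · rw [whittleIndex_one] at h₃
    have hn1 : n = 1 := by
      by_contra hne
      have := whittleIndex_strictMono (hp m) (show 1 < n by omega)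
      rw [whittleIndex_one] at this
      linarith
    subst hn1
    have hm : m = 1 := by
      by_contra hne
      have : m = 0 := by omega
      subst this
      exact h₁ (Or.inr ⟨rfl, rfl, rfl, rfl⟩)
    subst hm
    exact Or.inr ⟨rfl, rfl, rfl, rfl⟩

/-- Position of age `i ≥ 1` of class `k` in the alternating order of the priorities. -/
def rank (k : Fin 2) (i : ℕ) : ℕ := 2 * i - k

lemma rank_injective {k m : Fin 2} {i j : ℕ} (hi : 1 ≤ i) (hj : 1 ≤ j)
    (h : rank k i = rank m j) : k = m ∧ i = j := by
  have hk := k.isLt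
  have hm := m.isLt
  simp only [rank] at h
  refine ⟨Fin.ext ?_, ?_⟩ <;> omega

/-- Up to age `n`, the priorities of the two classes alternate. -/
def Alternates (p : Fin 2 → ℝ) (n : ℕ) : Prop :=
  ∀ j, 1 ≤ j → j ≤ n → whittleIndex (p 0) j < whittleIndex (p 1) (j + 1)

lemma Alternates.lowerPriority {p : Fin 2 → ℝ} {n : ℕ} (h : Alternates p n)
    (hp_pos : 0 < p 1) (hp_lt : p 1 < p 0) {k m : Fin 2} {i j : ℕ} (hi : 1 ≤ i) (hin : i ≤ n)
    (hr : rank k i < rank m j) : LowerPriority p k i m j := by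
  have m0 := whittleIndex_strictMono (hp_pos.trans hp_lt)
  have m1 := whittleIndex_strictMono hp_pos
  simp only [rank] at hr
  fin_cases k <;> fin_cases m <;> simp at hr ⊢
  · exact Or.inl (m0 (by omega))
  · exact Or.inl ((h i hi hin).trans_le (m1.monotone (by omega)))
  · rcases hi.eq_or_lt with rfl | h2
    · by_cases hj : j = 1
      · exact Or.inr ⟨rfl, hj, rfl, rfl⟩
      · refine Or.inl ?_
        have := m0 (show 1 < j by omega)
        simpa [whittleIndex_one] using this
    · exact Or.inl ((whittleIndex_lt_whittleIndex hp_lt h2).trans_le (m0.monotone (by omega)))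
  · exact Or.inl (m1 (by omega))

/-- Clearing denominators, alternation at `j` reads `(p 0 - p 1) j² - (p 0 + p 1) j < 2`, and
`alternationBound p` is the positive root of the corresponding equation. -/
lemma alternates_of_lt_alternationBound {p : Fin 2 → ℝ} (hp_pos : 0 < p 1) (hp_lt : p 1 < p 0)
    {n : ℕ} (hn : (n : ℝ) < alternationBound p) : Alternates p n := by
  intro j hj hjn
  have hjD : (j : ℝ) < alternationBound p := lt_of_le_of_lt (by exact_mod_cast hjn) hn
  have hj0 : (1 : ℝ) ≤ j := by exact_mod_cast hj
  have hd : 0 < p 0 - p 1 := by linarith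
  rw [alternationBound, one_div, inv_mul_eq_div, lt_div_iff₀ hd] at hjD
  have key : (p 0 - p 1) * (j : ℝ) ^ 2 - (p 0 + p 1) * j < 2 := by
    rcases le_or_gt 0 (j * (p 0 - p 1) - (p 0 + p 1) / 2) with h | h
    · have h1 : (j * (p 0 - p 1) - (p 0 + p 1) / 2) <
        √(2 * (p 0 - p 1) + (p 0 + p 1) ^ 2 / 4) := by linarith
      have h2 := (Real.lt_sqrt h).1 h1
      have h3 : (p 0 - p 1) * ((p 0 - p 1) * (j : ℝ) ^ 2 - (p 0 + p 1) * j) < (p 0 - p 1) * 2 := by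
        nlinarith
      exact lt_of_mul_lt_mul_left h3 hd.le
    · have : (p 0 - p 1) * (j : ℝ) - (p 0 + p 1) < 0 := by nlinarith
      nlinarith
  simp only [whittleIndex]
  push_cast
  nlinarith

lemma two_lt_alternationBound {p : Fin 2 → ℝ} (hp_pos : 0 < p 1) (hp_lt : p 1 < p 0)
    (hp_one : p 0 < 1) : 2 < alternationBound p := by
  have hd : 0 < p 0 - p 1 := by linarith
  rw [alternationBound, one_div, inv_mul_eq_div, lt_div_iff₀ hd]
  have : 2 * (p 0 - p 1) - (p 0 + p 1) / 2 < √(2 * (p 0 - p 1) + (p 0 + p 1) ^ 2 / 4) := by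
    rcases le_or_gt 0 (2 * (p 0 - p 1) - (p 0 + p 1) / 2) with h | h
    · rw [Real.lt_sqrt h]
      nlinarith [mul_pos hd hd]
    · exact h.trans_le (Real.sqrt_nonneg _)
  linarith

lemma exists_alternates {p : Fin 2 → ℝ} {α : ℝ} (hp_pos : 0 < p 1) (hp_lt : p 1 < p 0)
    (hp_one : p 0 < 1) (hα : 1 / (1 + (alternationBound p - 2) * p 1) < α) (hα_one : α < 1) :
    0 < α ∧ ∃ n : ℕ, 1 ≤ n ∧ 1 - α < n * p 1 * α ∧ Alternates p (n + 1) := by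
  have hD := two_lt_alternationBound hp_pos hp_lt hp_one
  have h1 : 0 < 1 + (alternationBound p - 2) * p 1 := by nlinarith
  have hα0 : 0 < α := lt_trans (by positivity) hα
  rw [div_lt_iff₀ h1] at hα
  have hpa : 0 < p 1 * α := by positivity
  have hx : (1 - α) / (p 1 * α) < alternationBound p - 2 := by
    rw [div_lt_iff₀ hpa]; nlinarith
  have hx0 : 0 ≤ (1 - α) / (p 1 * α) := div_nonneg (by linarith) hpa.le
  -- This `n` exceeds `(1 - α) / (p 1 * α)`, while `n + 1` is its floor plus `2`, hence below
  -- `alternationBound p`: this is the `2` subtracted in the hypothesis on `α`.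
  refine ⟨hα0, ⌊(1 - α) / (p 1 * α)⌋₊ + 1, by omega, ?_, ?_⟩
  · have := Nat.lt_floor_add_one ((1 - α) / (p 1 * α))
    rw [div_lt_iff₀ hpa] at this
    push_cast
    linarith
  · apply alternates_of_lt_alternationBound hp_pos hp_lt
    have := Nat.floor_le hx0
    push_cast
    linarith

/-! ### Idle masses along a trajectory -/

/-- The masses that are not scheduled. -/
def idle (z s : Profile) (k : Fin 2) (i : ℕ) : ℝ := z k i - s k i

lemma hasSum_fin_prod {f : Fin 2 → ℕ → ℝ} {a : Fin 2 → ℝ} (hf : ∀ k i, 0 ≤ f k i)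
    (h : ∀ k, HasSum (f k) (a k)) :
    HasSum (fun q : Fin 2 × ℕ => f q.1 q.2) (a 0 + a 1) := by
  have hs : Summable (fun q : Fin 2 × ℕ => f q.1 q.2) :=
    (summable_prod_of_nonneg fun q => hf q.1 q.2).2
      ⟨fun k => (h k).summable, (hasSum_fintype _).summable⟩
  have := hs.hasSum.prod_fiberwise fun k => h k
  have h2 := hasSum_fintype (fun k => a k)
  rw [Fin.sum_univ_two] at h2
  rw [h2.unique this]
  exact hs.hasSum

section Slot

variable {p γ : Fin 2 → ℝ} {α : ℝ} {z s : Profile}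

lemma IsAdmissible.hasSum (hz : IsState γ z) (h : IsAdmissible z s) (k : Fin 2) :
    HasSum (s k) (scheduled s k) :=
  (Summable.of_nonneg_of_le (fun i => (h k i).1) (fun i => (h k i).2) (hz k).2.2.summable).hasSum

lemma IsAdmissible.hasSum_idle (hz : IsState γ z) (h : IsAdmissible z s) (k : Fin 2) :
    HasSum (idle z s k) (γ k - scheduled s k) :=
  (hz k).2.2.sub (h.hasSum hz k)

lemma IsAdmissible.idle_nonneg (h : IsAdmissible z s) (k : Fin 2) (i : ℕ) : 0 ≤ idle z s k i :=
  sub_nonneg.2 (h k i).2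

lemma IsAdmissible.eq_zero (hz : IsState γ z) (h : IsAdmissible z s) (k : Fin 2) :
    s k 0 = 0 :=
  le_antisymm ((h k 0).2.trans_eq (hz k).1) (h k 0).1

lemma IsAdmissible.idle_eq_zero (hz : IsState γ z) (h : IsAdmissible z s) (k : Fin 2) :
    idle z s k 0 = 0 := by
  rw [idle, h.eq_zero hz, (hz k).1, sub_zero]

lemma scheduled_nonneg (h : IsAdmissible z s) (k : Fin 2) : 0 ≤ scheduled s k :=
  tsum_nonneg fun i => (h k i).1

lemma scheduled_le (hz : IsState γ z) (h : IsAdmissible z s) (k : Fin 2) :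
    scheduled s k ≤ γ k :=
  hasSum_le (fun i => (h k i).2) (h.hasSum hz k) (hz k).2.2

lemma IsState.next (hz : IsState γ z) (h : IsAdmissible z s) (hp : ∀ k, 0 ≤ p k)
    (hp_one : ∀ k, p k ≤ 1) : IsState γ (next p z s) := by
  intro k
  refine ⟨rfl, ?_, ?_⟩
  · rintro (_ | _ | i)
    · exact le_rfl
    · exact mul_nonneg (hp k) (scheduled_nonneg h k)
    · have h1 := h k (i + 1)
      have : p k * s k (i + 1) ≤ s k (i + 1) := mul_le_of_le_one_left h1.1 (hp_one k)
      simp only [AgeFluid.next]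
      linarith
  · have h1 : HasSum (fun i => z k i - p k * s k i) (γ k - p k * scheduled s k) :=
      (hz k).2.2.sub ((h.hasSum hz k).mul_left _)
    rw [← hasSum_nat_add_iff' 1] at h1
    rw [← hasSum_nat_add_iff' 2]
    convert h1 using 1
    · simp [AgeFluid.next]
    · simp [Finset.sum_range_succ, AgeFluid.next, (hz k).1, h.eq_zero hz]

lemma hasSum_idle_prod (hγ : γ 0 + γ 1 = 1) (hz : IsState γ z) (h : IsWhittleSchedule p α z s) :
    HasSum (fun q : Fin 2 × ℕ => idle z s q.1 q.2) (1 - α) := by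
  have h2 := h.2.1
  rw [Fin.sum_univ_two] at h2
  have := hasSum_fin_prod h.1.idle_nonneg (h.1.hasSum_idle hz)
  convert this using 1
  linarith

lemma IsWhittleSchedule.eq_zero_of_idle_pos (h : IsWhittleSchedule p α z s) {k m : Fin 2}
    {i j : ℕ} (hi : 1 ≤ i) (hj : 1 ≤ j) (hl : LowerPriority p k i m j) (hv : 0 < idle z s m j) :
    s k i = 0 := by
  by_contra hne
  have := h.2.2 k i m j hi hj hl (lt_of_le_of_ne (h.1 k i).1 (Ne.symm hne))
  rw [idle, this, sub_self] at hv
  exact lt_irrefl _ hv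

end Slot

/-- The standing assumptions on the parameters and on a trajectory. -/
structure Regime (p γ : Fin 2 → ℝ) (α : ℝ) (n : ℕ) : Prop where
  pos : 0 < p 1
  lt : p 1 < p 0
  lt_one : p 0 < 1
  mass_pos : ∀ k, 0 < γ k
  mass_sum : γ 0 + γ 1 = 1
  budget_pos : 0 < α
  budget_lt : α < 1
  one_le : 1 ≤ n
  overload : 1 - α < n * p 1 * α
  alternates : Alternates p (n + 1)

namespace Regime

variable {p γ : Fin 2 → ℝ} {α : ℝ} {n : ℕ}

lemma p_pos (h : Regime p γ α n) (k : Fin 2) : 0 < p k := by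
  fin_cases k
  · exact h.pos.trans h.lt
  · exact h.pos

lemma p_lt_one (h : Regime p γ α n) (k : Fin 2) : p k < 1 := by
  fin_cases k
  · exact h.lt_one
  · exact h.lt.trans h.lt_one

lemma p_le (h : Regime p γ α n) (k : Fin 2) : p k ≤ p 0 := by
  fin_cases k
  · exact le_rfl
  · exact h.lt.le

lemma le_p (h : Regime p γ α n) (k : Fin 2) : p 1 ≤ p k := by
  fin_cases k
  · exact h.lt.le
  · exact le_rfl

lemma lowerPriority (h : Regime p γ α n) {k m : Fin 2} {i j : ℕ} (hi : 1 ≤ i) (hin : i ≤ n + 1)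
    (hr : rank k i < rank m j) : LowerPriority p k i m j :=
  h.alternates.lowerPriority h.pos h.lt hi hin hr

end Regime

/-! ### Idle masses from slot to slot, and the bound `n` on their age -/

section Trajectory

variable {p γ : Fin 2 → ℝ} {α : ℝ} {n : ℕ} {z s : ℕ → Profile}

lemma IsFluidTrajectory.isState (H : Regime p γ α n) (h : IsFluidTrajectory p γ α z s) (t : ℕ) :
    IsState γ (z t) := by
  induction t with
  | zero => exact h.1
  | succ t ih =>
    rw [(h.2 t).2]
    exact ih.next (h.2 t).1.1 (fun k => (H.p_pos k).le) (fun k => (H.p_lt_one k).le)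

lemma IsFluidTrajectory.shift (H : Regime p γ α n) (h : IsFluidTrajectory p γ α z s) (N : ℕ) :
    IsFluidTrajectory p γ α (fun t => z (t + N)) (fun t => s (t + N)) := by
  refine ⟨h.isState H _, fun t => ⟨(h.2 _).1, ?_⟩⟩
  have := (h.2 (t + N)).2
  rw [show t + N + 1 = t + 1 + N by ring] at this
  exact this

lemma IsFluidTrajectory.apply_one (h : IsFluidTrajectory p γ α z s) (t : ℕ) (k : Fin 2) :
    z (t + 1) k 1 = p k * scheduled (s t) k := by
  rw [(h.2 t).2]; rfl

lemma IsFluidTrajectory.apply_succ (h : IsFluidTrajectory p γ α z s) (t : ℕ) (k : Fin 2)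
    {i : ℕ} (hi : 1 ≤ i) : z (t + 1) k (i + 1) = z t k i - p k * s t k i := by
  obtain ⟨j, rfl⟩ := Nat.exists_eq_add_of_le' hi
  rw [(h.2 t).2]; rfl

lemma IsFluidTrajectory.idle_nonneg (h : IsFluidTrajectory p γ α z s) (t : ℕ) (k : Fin 2)
    (i : ℕ) : 0 ≤ idle (z t) (s t) k i :=
  (h.2 t).1.1.idle_nonneg k i

lemma IsFluidTrajectory.idle_le_succ (H : Regime p γ α n) (h : IsFluidTrajectory p γ α z s)
    (t : ℕ) (k : Fin 2) {i : ℕ} (hi : 1 ≤ i) :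
    idle (z t) (s t) k i ≤ z (t + 1) k (i + 1) := by
  rw [h.apply_succ t k hi, idle]
  have h1 := ((h.2 t).1.1 k i).1
  nlinarith [H.p_lt_one k]

/-- Idle mass survives one slot, one age older, and is idle again if nothing is scheduled there. A
further idle mass must fit with it into the total `1 - α`. -/
lemma IsFluidTrajectory.sum_idle_add_le (H : Regime p γ α n) (h : IsFluidTrajectory p γ α z s)
    (t : ℕ) (Q : Finset (Fin 2 × ℕ)) (k : Fin 2) (i : ℕ)
    (hQ : ∀ q ∈ Q, 1 ≤ q.2 ∧ s (t + 1) q.1 (q.2 + 1) = 0 ∧ (q.1, q.2 + 1) ≠ (k, i)) :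
    ∑ q ∈ Q, idle (z t) (s t) q.1 q.2 + idle (z (t + 1)) (s (t + 1)) k i ≤ 1 - α := by
  let e : Fin 2 × ℕ ↪ Fin 2 × ℕ :=
    ⟨fun q => (q.1, q.2 + 1), fun a b hab => by
      simp only [Prod.mk.injEq, add_left_inj] at hab
      exact Prod.ext hab.1 hab.2⟩
  have hsum := hasSum_idle_prod H.mass_sum (h.isState H (t + 1)) (h.2 (t + 1)).1
  have hmem : (k, i) ∉ Q.map e := by
    simp only [Finset.mem_map, not_exists, not_and]
    intro q hq
    exact (hQ q hq).2.2
  have h1 := sum_le_hasSum (insert (k, i) (Q.map e))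
    (fun q _ => h.idle_nonneg (t + 1) q.1 q.2) hsum
  rw [Finset.sum_insert hmem, Finset.sum_map] at h1
  have h2 : ∑ q ∈ Q, idle (z t) (s t) q.1 q.2 ≤
      ∑ q ∈ Q, idle (z (t + 1)) (s (t + 1)) (e q).1 (e q).2 := by
    refine Finset.sum_le_sum fun q hq => ?_
    have h3 := h.idle_le_succ H t q.1 (hQ q hq).1
    change _ ≤ idle (z (t + 1)) (s (t + 1)) q.1 (q.2 + 1)
    conv_rhs => rw [idle, (hQ q hq).2.1, sub_zero]
    exact h3
  linarith

lemma IsFluidTrajectory.sum_idle_eq (H : Regime p γ α n) (h : IsFluidTrajectory p γ α z s)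
    (t : ℕ) (Q : Finset (Fin 2 × ℕ)) (hQ : ∀ k i, 1 ≤ i → (k, i) ∉ Q → idle (z t) (s t) k i = 0) :
    ∑ q ∈ Q, idle (z t) (s t) q.1 q.2 = 1 - α := by
  have h0 := hasSum_idle_prod H.mass_sum (h.isState H t) (h.2 t).1
  refine HasSum.unique (hasSum_sum_of_ne_finset_zero fun q hq => ?_) h0
  rcases Nat.eq_zero_or_pos q.2 with h1 | h1
  · rw [h1, (h.2 t).1.1.idle_eq_zero (h.isState H t)]
  · exact hQ q.1 q.2 h1 hq

/-- Pairs of a class and an age of rank below `ρ`. -/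
def below (ρ : ℕ) : Finset (Fin 2 × ℕ) :=
  (Finset.univ ×ˢ Finset.range (ρ + 1)).filter fun q => 1 ≤ q.2 ∧ rank q.1 q.2 < ρ

lemma mem_below {ρ : ℕ} {k : Fin 2} {i : ℕ} : (k, i) ∈ below ρ ↔ 1 ≤ i ∧ rank k i < ρ := by
  have := k.isLt
  rw [below, Finset.mem_filter, Finset.mem_product]
  refine ⟨fun h => h.2, fun h => ⟨⟨Finset.mem_univ _, Finset.mem_range.2 ?_⟩, h⟩⟩
  simp only [rank] at h ⊢
  omega

lemma rank_succ (k : Fin 2) {i : ℕ} (hi : 1 ≤ i) : rank k (i + 1) = rank k i + 2 := by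
  have := k.isLt
  simp only [rank]; omega

lemma IsFluidTrajectory.scheduled_eq_zero (H : Regime p γ α n) (h : IsFluidTrajectory p γ α z s)
    {t : ℕ} {ρ : ℕ} (hρ : ρ ≤ 2 * n + 3)
    (hv : ∃ k i, 1 ≤ i ∧ ρ ≤ rank k i ∧ 0 < idle (z t) (s t) k i) {m : Fin 2} {j : ℕ}
    (hj : 1 ≤ j) (hr : rank m j < ρ) : s t m j = 0 := by
  obtain ⟨k, i, hi, hki, hv⟩ := hv
  refine (h.2 t).1.eq_zero_of_idle_pos hj hi (H.lowerPriority hj ?_ (hr.trans_le hki)) hv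
  have := m.isLt
  simp only [rank] at hr
  omega

/-- Otherwise all of the idle mass `1 - α` lies below rank `ρ`, moves up by two ranks, and stays
idle below the given idle mass, whose addition exceeds the total. -/
lemma IsFluidTrajectory.exists_idle_pos (H : Regime p γ α n) (h : IsFluidTrajectory p γ α z s)
    {t : ℕ} {ρ : ℕ} (hρ : ρ ≤ 2 * n + 1)
    (hv : ∃ k i, 1 ≤ i ∧ ρ + 2 ≤ rank k i ∧ 0 < idle (z (t + 1)) (s (t + 1)) k i) :
    ∃ k i, 1 ≤ i ∧ ρ ≤ rank k i ∧ 0 < idle (z t) (s t) k i := by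
  by_contra! hcon
  have h1 := h.sum_idle_eq H t (below ρ) fun k i hi hk => by
    refine le_antisymm (hcon k i hi ?_) (h.idle_nonneg t k i)
    by_contra! hlt
    exact hk (mem_below.2 ⟨hi, hlt⟩)
  have hs := fun {m : Fin 2} {j : ℕ} => h.scheduled_eq_zero H (m := m) (j := j) (by omega) hv
  obtain ⟨k, i, hi, hki, hv⟩ := hv
  have h2 := h.sum_idle_add_le H t (below ρ) k i fun q hq => by
    obtain ⟨h3, h4⟩ := mem_below.1 hq
    have h5 := rank_succ q.1 h3
    refine ⟨h3, hs (by omega) (by omega), fun h6 => ?_⟩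
    simp only [Prod.mk.injEq] at h6
    rw [h6.1, h6.2] at h5
    rw [h6.1] at h4
    omega
  linarith

/-- Below an idle mass, every user has been idle since its age was `1`. -/
lemma IsFluidTrajectory.apply_eq (H : Regime p γ α n) (h : IsFluidTrajectory p γ α z s)
    (τ : ℕ) {ρ : ℕ} (hρ : ρ ≤ 2 * n + 3) {j : ℕ} (hj : 1 ≤ j) {m : Fin 2} (hr : rank m j < ρ)
    (hv : ∃ k i, 1 ≤ i ∧ ρ ≤ rank k i ∧ 0 < idle (z (τ + j)) (s (τ + j)) k i) :
    z (τ + j) m j = p m * scheduled (s τ) m ∧ s (τ + j) m j = 0 := by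
  induction j, hj using Nat.le_induction generalizing ρ with
  | base => exact ⟨h.apply_one τ m, h.scheduled_eq_zero H hρ hv le_rfl hr⟩
  | succ j hj ih =>
    refine ⟨?_, h.scheduled_eq_zero H hρ hv (by omega) hr⟩
    have h1 := rank_succ m hj
    -- One slot back, ages drop by one and ranks by two, so the induction hypothesis is used at `ρ -
    -- 2`.
    obtain ⟨ρ, rfl⟩ := Nat.exists_eq_add_of_le' (show 2 ≤ ρ by omega)
    obtain ⟨h2, h3⟩ := ih (ρ := ρ) (by omega) (by omega)
      (h.exists_idle_pos H (t := τ + j) (by omega) hv)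
    rw [← add_assoc, h.apply_succ _ _ hj, h2, h3, mul_zero, sub_zero]

/-- Idle mass at such an age makes each cohort of the last `n` slots entirely idle. A cohort of both
classes together has mass at least `p 1 * α`, so `overload` is contradicted. -/
lemma IsFluidTrajectory.idle_eq_zero_of_lt (H : Regime p γ α n)
    (h : IsFluidTrajectory p γ α z s) {t : ℕ} (ht : n ≤ t) {m : Fin 2} {j : ℕ} (hj : n < j) :
    idle (z t) (s t) m j = 0 := by
  by_contra hne
  have hpos := lt_of_le_of_ne (h.idle_nonneg t m j) (Ne.symm hne)
  have hv : ∃ k i, 1 ≤ i ∧ 2 * n + 1 ≤ rank k i ∧ 0 < idle (z t) (s t) k i := by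
    refine ⟨m, j, by omega, ?_, hpos⟩
    have := m.isLt
    simp only [rank]; omega
  have h1 : ∀ k : Fin 2, ∀ i, 1 ≤ i → i ≤ n →
      idle (z t) (s t) k i = p k * scheduled (s (t - i)) k := by
    intro k i hi hin
    have h2 := h.apply_eq H (t - i) (ρ := 2 * n + 1) (by omega) hi (m := k)
      (by simp only [rank]; omega) (by rwa [Nat.sub_add_cancel (by omega)])
    rw [Nat.sub_add_cancel (by omega)] at h2
    rw [idle, h2.1, h2.2, sub_zero]
  have h3 := sum_le_hasSum (Finset.univ ×ˢ Finset.Icc 1 n) (fun q _ => h.idle_nonneg t q.1 q.2)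
    (hasSum_idle_prod H.mass_sum (h.isState H t) (h.2 t).1)
  rw [Finset.sum_product_right] at h3
  have h4 : ∑ i ∈ Finset.Icc 1 n, p 1 * α ≤
      ∑ i ∈ Finset.Icc 1 n, ∑ k, idle (z t) (s t) k i := by
    refine Finset.sum_le_sum fun i hi => ?_
    obtain ⟨hi, hin⟩ := Finset.mem_Icc.1 hi
    have h5 := (h.2 (t - i)).1.2.1
    rw [← h5, Finset.mul_sum]
    refine Finset.sum_le_sum fun k _ => ?_
    rw [h1 k i hi hin]
    exact mul_le_mul_of_nonneg_right (H.le_p k) (scheduled_nonneg (h.2 (t - i)).1.1 k)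
  rw [Finset.sum_const, Nat.card_Icc, nsmul_eq_mul] at h4
  simp only [Nat.add_sub_cancel] at h4
  have := H.overload
  linarith

/-- Idle masses of an age come from idle masses of the previous age. -/
lemma IsFluidTrajectory.idle_succ_le (H : Regime p γ α n) (h : IsFluidTrajectory p γ α z s)
    (t : ℕ) (k : Fin 2) {i : ℕ} (hi : 1 ≤ i) (hin : i ≤ n) :
    idle (z (t + 1)) (s (t + 1)) k (i + 1) ≤ idle (z t) (s t) k i := by
  rcases (h.idle_nonneg (t + 1) k (i + 1)).eq_or_lt with h0 | hpos
  · rw [← h0]; exact h.idle_nonneg t k i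
  rcases ((h.2 t).1.1 k i).1.eq_or_lt with h0 | hs
  · have := h.apply_succ t k hi
    rw [← h0, mul_zero, sub_zero] at this
    rw [idle, this, idle, ← h0, sub_zero]
    linarith [((h.2 (t + 1)).1.1 k (i + 1)).1]
  have hk := k.isLt
  have hr : rank k (i + 1) ≤ 2 * n + 3 := by simp only [rank]; omega
  have hr2 := rank_succ k hi
  -- Since some of `(k, i)` is scheduled, all idle mass at `t` has rank at most that of `(k, i)`.
  -- The part strictly below stays idle, so at most `idle (z t) (s t) k i` is left for `(k, i + 1)`.
  have h1 := h.sum_idle_eq H t (insert (k, i) (below (rank k i))) fun m j hj hmj => by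
    rw [Finset.mem_insert, not_or, mem_below, not_and, not_lt] at hmj
    have h2 : rank k i < rank m j := by
      refine lt_of_le_of_ne (hmj.2 hj) fun h3 => hmj.1 ?_
      obtain ⟨rfl, rfl⟩ := rank_injective hi hj h3
      rfl
    rw [idle, (h.2 t).1.2.2 k i m j hi hj (H.lowerPriority hi (by omega) h2) hs, sub_self]
  rw [Finset.sum_insert (by rw [mem_below]; omega)] at h1
  have h2 := h.sum_idle_add_le H t (below (rank k i)) k (i + 1) fun q hq => by
    obtain ⟨h3, h4⟩ := mem_below.1 hq
    have h5 := rank_succ q.1 h3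
    refine ⟨h3, h.scheduled_eq_zero H hr ⟨k, i + 1, by omega, le_rfl, hpos⟩ (by omega) (by omega),
      fun h6 => ?_⟩
    simp only [Prod.mk.injEq, add_left_inj] at h6
    rw [h6.1, h6.2] at h4
    omega
  linarith

lemma IsFluidTrajectory.idle_le (H : Regime p γ α n) (h : IsFluidTrajectory p γ α z s)
    (τ : ℕ) (k : Fin 2) {i : ℕ} (hi : 1 ≤ i) (hin : i ≤ n) :
    idle (z (τ + i)) (s (τ + i)) k i ≤ p k * scheduled (s τ) k := by
  induction i, hi using Nat.le_induction with
  | base =>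
    rw [idle, h.apply_one]
    linarith [((h.2 (τ + 1)).1.1 k 1).1]
  | succ i hi ih => exact (h.idle_succ_le H (τ + i) k hi (by omega)).trans (ih (by omega))

end Trajectory

/-! ### Convergence of averaging sequences -/

section Window

variable {A : ℕ → ℝ} {N : ℕ} {r : ℝ}

lemma le_of_window (hr : 0 ≤ r)
    (hU : ∀ t B, (∀ i ≤ N, A (t + i) ≤ B) → A (t + N + 1) ≤ r * A (t + N) + (1 - r) * B)
    {t : ℕ} {B : ℝ} (h : ∀ i ≤ N, A (t + i) ≤ B) (i : ℕ) : A (t + i) ≤ B := by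
  induction i using Nat.strong_induction_on with
  | _ i ih =>
    rcases le_or_gt i N with hi | hi
    · exact h i hi
    · obtain ⟨j, rfl⟩ := Nat.exists_eq_add_of_lt hi
      have h1 := hU (t + j) B fun l hl => by
        rw [add_assoc]; exact ih _ (by omega)
      have h2 := ih (j + N) (by omega)
      rw [show t + (N + j + 1) = t + j + N + 1 by ring]
      rw [show t + (j + N) = t + j + N by ring] at h2
      nlinarith

/-- A gap `δ` below the bound loses at most a factor `r` per step, so a share `r ^ N` of it survives
throughout the next window. -/
lemma le_sub_of_window (hr : 0 < r) (hr1 : r ≤ 1)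
    (hU : ∀ t B, (∀ i ≤ N, A (t + i) ≤ B) → A (t + N + 1) ≤ r * A (t + N) + (1 - r) * B)
    {t : ℕ} {B δ : ℝ} (hδ : 0 ≤ δ) (h : ∀ i ≤ N, A (t + i) ≤ B) (hA : A (t + N) ≤ B - δ)
    {i : ℕ} (hi : i ≤ N) : A (t + N + i) ≤ B - r ^ N * δ := by
  have h1 : ∀ j, A (t + N + j) ≤ B - r ^ j * δ := by
    intro j
    induction j with
    | zero => simpa using hA
    | succ j ih =>
      have h1 := hU (t + j) B fun l _ => by
        rw [add_assoc]; exact le_of_window hr.le hU h _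
      rw [show t + j + N = t + N + j by ring] at h1
      rw [← add_assoc, pow_succ]
      nlinarith
  have h2 : r ^ N ≤ r ^ i := pow_le_pow_of_le_one hr.le hr1 hi
  have := h1 i
  nlinarith

lemma exists_tendsto_of_window (hr : 0 < r) (hr1 : r ≤ 1)
    (hU : ∀ t B, (∀ i ≤ N, A (t + i) ≤ B) → A (t + N + 1) ≤ r * A (t + N) + (1 - r) * B)
    (hL : ∀ t B, (∀ i ≤ N, B ≤ A (t + i)) → r * A (t + N) + (1 - r) * B ≤ A (t + N + 1)) :
    ∃ a, Tendsto A atTop (𝓝 a) := by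
  have hU' : ∀ t B, (∀ i ≤ N, -A (t + i) ≤ B) →
      -A (t + N + 1) ≤ r * -A (t + N) + (1 - r) * B := by
    intro t B h
    have := hL t (-B) fun i hi => by linarith [h i hi]
    linarith
  have step : ∀ t m M, m ≤ M → (∀ i ≤ N, m ≤ A (t + i)) → (∀ i ≤ N, A (t + i) ≤ M) →
      ∃ m' M', m' ≤ M' ∧ M' - m' = (1 - r ^ N / 2) * (M - m) ∧
        (∀ i ≤ N, m' ≤ A (t + N + i)) ∧ (∀ i ≤ N, A (t + N + i) ≤ M') := by
    intro t m M hmM hm hM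
    have hN : r ^ N ≤ 1 := pow_le_one₀ hr.le hr1
    have hδ : 0 ≤ (M - m) / 2 := by linarith
    -- The last value of the window is at least half the width away from one of the two bounds, and
    -- that bound improves.
    rcases le_total (A (t + N)) ((m + M) / 2) with h | h
    · refine ⟨m, M - r ^ N * ((M - m) / 2), ?_, by ring, fun i _ => ?_, fun i hi => ?_⟩
      · nlinarith
      · have := le_of_window (A := fun t => -A t) hr.le hU' (t := t) (B := -m)
          (fun i hi => neg_le_neg (hm i hi)) (N + i)
        rw [add_assoc]
        linarith
      · exact le_sub_of_window hr hr1 hU hδ hM (by linarith) hi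
    · refine ⟨m + r ^ N * ((M - m) / 2), M, ?_, by ring, fun i hi => ?_, fun i _ => ?_⟩
      · nlinarith
      · have := le_sub_of_window (A := fun t => -A t) hr hr1 hU' hδ (t := t) (B := -m)
          (fun i hi => neg_le_neg (hm i hi)) (by linarith) hi
        linarith
      · rw [add_assoc]
        exact le_of_window hr.le hU hM _
  set ρ := 1 - r ^ N / 2 with hρ
  have hρ0 : 0 ≤ ρ := by
    have hN : r ^ N ≤ 1 := pow_le_one₀ hr.le hr1
    linarith
  have hρ1 : ρ < 1 := by
    have hN : 0 < r ^ N := pow_pos hr N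
    linarith
  obtain ⟨D, hD⟩ : ∃ D, ∀ k : ℕ, ∃ t m M, m ≤ M ∧ M - m ≤ ρ ^ k * D ∧
      (∀ i ≤ N, m ≤ A (t + i)) ∧ (∀ i ≤ N, A (t + i) ≤ M) := by
    refine ⟨∑ i ∈ Finset.range (N + 1), |A i| - -∑ i ∈ Finset.range (N + 1), |A i|, fun k => ?_⟩
    have hle : ∀ i ≤ N, |A i| ≤ ∑ i ∈ Finset.range (N + 1), |A i| := fun i hi =>
      Finset.single_le_sum (f := fun i => |A i|) (fun _ _ => abs_nonneg _)
        (Finset.mem_range.2 (by omega))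
    induction k with
    | zero =>
      refine ⟨0, -∑ i ∈ Finset.range (N + 1), |A i|, ∑ i ∈ Finset.range (N + 1), |A i|, ?_,
        by simp, fun i hi => ?_, fun i hi => ?_⟩
      · have := (abs_nonneg _).trans (hle 0 (by omega))
        linarith
      · rw [zero_add]; exact (abs_le.1 (hle i hi)).1
      · rw [zero_add]; exact (abs_le.1 (hle i hi)).2
    | succ k ih =>
      obtain ⟨t, m, M, hmM, hk, hm, hM⟩ := ih
      obtain ⟨m', M', h1, h2, h3, h4⟩ := step t m M hmM hm hM
      refine ⟨t + N, m', M', h1, ?_, h3, h4⟩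
      rw [h2, pow_succ', mul_assoc]
      exact mul_le_mul_of_nonneg_left hk hρ0
  refine cauchySeq_tendsto_of_complete (Metric.cauchySeq_iff'.2 fun ε hε => ?_)
  have hlim : Tendsto (fun k : ℕ => ρ ^ k * D) atTop (𝓝 (0 * D)) :=
    (tendsto_pow_atTop_nhds_zero_of_lt_one hρ0 hρ1).mul_const D
  rw [zero_mul] at hlim
  obtain ⟨k, hk⟩ := (hlim.eventually (gt_mem_nhds hε)).exists
  obtain ⟨t, m, M, -, h1, h2, h3⟩ := hD k
  refine ⟨t, fun l hl => ?_⟩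
  have hup := le_of_window hr.le hU h3
  have hlo := le_of_window (A := fun t => -A t) hr.le hU' (t := t) (B := -m)
    fun i hi => neg_le_neg (h2 i hi)
  obtain ⟨j, rfl⟩ := Nat.exists_eq_add_of_le hl
  have a1 := hup j
  have a2 := hlo j
  have a3 := hup 0
  have a4 := hlo 0
  simp only [add_zero] at a3 a4
  rw [Real.dist_eq, abs_lt]
  constructor <;> linarith

end Window

/-! ### Threshold shaped weights -/

/-- `c k i` is the idle fraction of the users of class `k` and age `i`; the slot `i = 0` is `1`. -/
structure IsThresholdShaped (n : ℕ) (c : Fin 2 → ℕ → ℝ) : Prop where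
  nonneg : ∀ k i, 0 ≤ c k i
  le_one : ∀ k i, c k i ≤ 1
  zero : ∀ k, c k 0 = 1
  top : ∀ k i, n < i → c k i = 0
  eq_one : ∀ k i m j, 1 ≤ i → 1 ≤ j → rank m j < rank k i → 0 < c k i → c m j = 1

/-- If the families cross, the one that is larger, hence positive, at the higher of the two ranks
equals `1` at the lower rank, where it should be strictly smaller than the other. -/
lemma IsThresholdShaped.le_total {n : ℕ} {c d : Fin 2 → ℕ → ℝ} (hc : IsThresholdShaped n c)
    (hd : IsThresholdShaped n d) : (∀ k i, c k i ≤ d k i) ∨ ∀ k i, d k i ≤ c k i := by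
  by_contra! h
  obtain ⟨⟨k, i, h1⟩, m, j, h2⟩ := h
  have hi : 1 ≤ i := by
    by_contra hi
    obtain rfl : i = 0 := by omega
    rw [hc.zero, hd.zero] at h1
    exact lt_irrefl _ h1
  have hj : 1 ≤ j := by
    by_contra hj
    obtain rfl : j = 0 := by omega
    rw [hc.zero, hd.zero] at h2
    exact lt_irrefl _ h2
  rcases lt_trichotomy (rank m j) (rank k i) with h | h | h
  · have := hc.eq_one k i m j hi hj h ((hd.nonneg k i).trans_lt h1)
    linarith [hd.le_one m j]
  · obtain ⟨rfl, rfl⟩ := rank_injective hj hi h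
    exact lt_asymm h1 h2
  · have := hd.eq_one m j k i hj hi h ((hc.nonneg m j).trans_lt h2)
    linarith [hc.le_one k i]

/-- Scheduled proportions `a t k` driven by threshold shaped idle fractions: `c u` describes the
slot `u + n`. -/
structure ThresholdSystem (p γ : Fin 2 → ℝ) (α : ℝ) (n : ℕ) (a : ℕ → Fin 2 → ℝ)
    (c : ℕ → Fin 2 → ℕ → ℝ) : Prop where
  nonneg : ∀ t k, 0 ≤ a t k
  sum_eq : ∀ t, a t 0 + a t 1 = α
  shaped : ∀ u, IsThresholdShaped n (c u)
  succ_le : ∀ u k i, c (u + 1) k (i + 1) ≤ c u k i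
  balance : ∀ u k,
    γ k = a (u + n) k + p k * ∑ i ∈ Finset.range n, c u k (i + 1) * a (u + n - (i + 1)) k

namespace ThresholdSystem

variable {p γ : Fin 2 → ℝ} {α : ℝ} {n : ℕ} {a : ℕ → Fin 2 → ℝ} {c : ℕ → Fin 2 → ℕ → ℝ}

/-- The difference of two consecutive balance equations, aligned by cohort. The conventions `c u k 0
= 1` and `c (u + 1) k (n + 1) = 0` absorb the boundary terms. -/
lemma apply_succ (S : ThresholdSystem p γ α n a c) (u : ℕ) (k : Fin 2) :
    a (u + n + 1) k = (1 - p k) * a (u + n) k +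
      p k * ∑ i ∈ Finset.range (n + 1), (c u k i - c (u + 1) k (i + 1)) * a (u + n - i) k := by
  have h1 := S.balance u k
  have h2 := S.balance (u + 1) k
  have h3 : ∑ i ∈ Finset.range (n + 1), c u k i * a (u + n - i) k =
      ∑ i ∈ Finset.range n, c u k (i + 1) * a (u + n - (i + 1)) k + a (u + n) k := by
    rw [Finset.sum_range_succ', (S.shaped u).zero]
    simp
  have h4 : ∑ i ∈ Finset.range (n + 1), c (u + 1) k (i + 1) * a (u + n - i) k =
      ∑ i ∈ Finset.range n, c (u + 1) k (i + 1) * a (u + 1 + n - (i + 1)) k := by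
    rw [Finset.sum_range_succ, (S.shaped (u + 1)).top k (n + 1) (by omega), zero_mul, add_zero]
    refine Finset.sum_congr rfl fun i _ => ?_
    rw [show u + 1 + n - (i + 1) = u + n - i by omega]
  simp only [sub_mul, Finset.sum_sub_distrib]
  rw [h3, h4]
  rw [show u + 1 + n = u + n + 1 by ring] at h2 ⊢
  linarith

lemma sum_sub_eq (S : ThresholdSystem p γ α n a c) (u : ℕ) (k : Fin 2) :
    ∑ i ∈ Finset.range (n + 1), (c u k i - c (u + 1) k (i + 1)) =
      1 - ∑ i ∈ Finset.range n, (c (u + 1) k (i + 1) - c u k (i + 1)) := by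
  rw [Finset.sum_sub_distrib, Finset.sum_range_succ', Finset.sum_range_succ _ n,
    (S.shaped u).zero, (S.shaped (u + 1)).top k (n + 1) (by omega), Finset.sum_sub_distrib]
  ring

lemma le_of_le (S : ThresholdSystem p γ α n a c) (hp : ∀ k, 0 ≤ p k) (u : ℕ)
    (hc : ∀ k i, c u k i ≤ c (u + 1) k i) (k : Fin 2) {B : ℝ} (hB : 0 ≤ B)
    (h : ∀ i ≤ n, a (u + i) k ≤ B) :
    a (u + n + 1) k ≤ (1 - p k) * a (u + n) k + p k * B := by
  rw [S.apply_succ]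
  have h1 : ∑ i ∈ Finset.range (n + 1), (c u k i - c (u + 1) k (i + 1)) * a (u + n - i) k ≤
      (∑ i ∈ Finset.range (n + 1), (c u k i - c (u + 1) k (i + 1))) * B := by
    rw [Finset.sum_mul]
    refine Finset.sum_le_sum fun i hi => ?_
    have hi' := Finset.mem_range.1 hi
    refine mul_le_mul_of_nonneg_left ?_ (sub_nonneg.2 (S.succ_le u k i))
    rw [show u + n - i = u + (n - i) by omega]
    exact h _ (by omega)
  have h2 : (∑ i ∈ Finset.range (n + 1), (c u k i - c (u + 1) k (i + 1))) ≤ 1 := by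
    rw [S.sum_sub_eq]
    have : 0 ≤ ∑ i ∈ Finset.range n, (c (u + 1) k (i + 1) - c u k (i + 1)) :=
      Finset.sum_nonneg fun i _ => sub_nonneg.2 (hc k (i + 1))
    linarith
  have h3 := mul_le_mul_of_nonneg_left (h1.trans (mul_le_of_le_one_left hB h2)) (hp k)
  linarith

lemma ge_of_ge (S : ThresholdSystem p γ α n a c) (hp : ∀ k, 0 ≤ p k) (u : ℕ)
    (hc : ∀ k i, c (u + 1) k i ≤ c u k i) (k : Fin 2) {B : ℝ} (hB : 0 ≤ B)
    (h : ∀ i ≤ n, B ≤ a (u + i) k) :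
    (1 - p k) * a (u + n) k + p k * B ≤ a (u + n + 1) k := by
  rw [S.apply_succ]
  have h1 : (∑ i ∈ Finset.range (n + 1), (c u k i - c (u + 1) k (i + 1))) * B ≤
      ∑ i ∈ Finset.range (n + 1), (c u k i - c (u + 1) k (i + 1)) * a (u + n - i) k := by
    rw [Finset.sum_mul]
    refine Finset.sum_le_sum fun i hi => ?_
    have hi' := Finset.mem_range.1 hi
    refine mul_le_mul_of_nonneg_left ?_ (sub_nonneg.2 (S.succ_le u k i))
    rw [show u + n - i = u + (n - i) by omega]
    exact h _ (by omega)
  have h2 : 1 ≤ (∑ i ∈ Finset.range (n + 1), (c u k i - c (u + 1) k (i + 1))) := by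
    rw [S.sum_sub_eq]
    have : ∑ i ∈ Finset.range n, (c (u + 1) k (i + 1) - c u k (i + 1)) ≤ 0 :=
      Finset.sum_nonpos fun i _ => sub_nonpos.2 (hc k (i + 1))
    linarith
  have h3 := mul_le_mul_of_nonneg_left ((le_mul_of_one_le_left hB h2).trans h1) (hp k)
  linarith

/-- If the fractions fall, the bound comes from the other class through the constant sum. The common
rate `P ≥ p k` is allowed because `a (u + n) k ≤ B`. -/
lemma apply_succ_le (S : ThresholdSystem p γ α n a c) (hp : ∀ k, 0 ≤ p k) {P : ℝ}
    (hP : ∀ k, p k ≤ P) {k m : Fin 2} (hkm : ∀ t, a t k + a t m = α) (u : ℕ) {B : ℝ}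
    (h : ∀ i ≤ n, a (u + i) k ≤ B) :
    a (u + n + 1) k ≤ (1 - P) * a (u + n) k + P * B := by
  have hB := h n le_rfl
  rcases (S.shaped u).le_total (S.shaped (u + 1)) with hc | hc
  · have h1 := S.le_of_le hp u hc k ((S.nonneg _ k).trans hB) h
    nlinarith [hP k]
  · have hle : ∀ t, a t k ≤ α := fun t => by linarith [hkm t, S.nonneg t m]
    -- `ge_of_ge` needs a nonnegative lower bound, hence the truncation of `B` at `α`.
    have h1 := S.ge_of_ge hp u hc m (B := α - min B α) (sub_nonneg.2 (min_le_right _ _))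
      fun i hi => by
        have := le_min (h i hi) (hle (u + i))
        linarith [hkm (u + i)]
    have h2 := hkm (u + n)
    have h3 := hkm (u + n + 1)
    have h4 : p m * min B α ≤ p m * B := mul_le_mul_of_nonneg_left (min_le_left _ _) (hp m)
    rw [show a (u + n) m = α - a (u + n) k by linarith] at h1
    nlinarith [hP m]

lemma exists_tendsto (S : ThresholdSystem p γ α n a c) (hp : ∀ k, 0 ≤ p k) {P : ℝ}
    (hP : ∀ k, p k ≤ P) (hP1 : P < 1) : ∃ b, Tendsto (fun t => a t 0) atTop (𝓝 b) := by
  have hP0 : 0 ≤ P := (hp 0).trans (hP 0)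
  refine exists_tendsto_of_window (N := n) (r := 1 - P) (by linarith) (by linarith)
    (fun t B h => ?_) fun t B h => ?_
  · rw [sub_sub_cancel]
    exact S.apply_succ_le hp hP S.sum_eq t h
  · have h1 := S.apply_succ_le hp hP (k := 1) (m := 0) (fun t => by rw [add_comm, S.sum_eq]) t
      (B := α - B) fun i hi => by linarith [h i hi, S.sum_eq (t + i)]
    have h2 := S.sum_eq (t + n)
    have h3 := S.sum_eq (t + n + 1)
    rw [show a (t + n) 1 = α - a (t + n) 0 by linarith] at h1
    linarith

/-- The balance equation in the limit of converging scheduled proportions. -/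
lemma tendsto_sum (S : ThresholdSystem p γ α n a c) {k : Fin 2} {b : ℝ}
    (hb : Tendsto (fun t => a t k) atTop (𝓝 b)) :
    Tendsto (fun u => p k * ∑ i ∈ Finset.range n, c u k (i + 1) * b) atTop (𝓝 (γ k - b)) := by
  have h1 : Tendsto (fun u => ∑ i ∈ Finset.range n, c u k (i + 1) * (a (u + n - (i + 1)) k - b))
      atTop (𝓝 (∑ i ∈ Finset.range n, 0)) := by
    refine tendsto_finsetSum _ fun i hi => ?_
    have hi' := Finset.mem_range.1 hi
    have h2 : Tendsto (fun u => a (u + n - (i + 1)) k - b) atTop (𝓝 0) := by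
      have h3 := (hb.comp (tendsto_atTop_mono (fun u => show u ≤ u + n - (i + 1) by omega)
        tendsto_id)).sub_const b
      rwa [sub_self] at h3
    refine squeeze_zero_norm (fun u => ?_) (tendsto_zero_iff_abs_tendsto_zero _ |>.1 h2)
    rw [Real.norm_eq_abs, abs_mul, abs_of_nonneg ((S.shaped u).nonneg _ _)]
    exact mul_le_of_le_one_left (abs_nonneg _) ((S.shaped u).le_one _ _)
  have h2 := ((tendsto_add_atTop_iff_nat n).2 hb).const_sub (γ k)
  have h3 := h2.sub (h1.const_mul (p k))
  simp only [Finset.sum_const_zero, mul_zero, sub_zero] at h3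
  refine h3.congr fun u => ?_
  rw [S.balance u k]
  simp only [mul_sub, Finset.sum_sub_distrib]
  ring

/-- With limits `y k`, the balance equations give `δ u k` the limit `(b k - y k) * (1 + p k * τ k)`.
Comparability with `d` makes `δ u 0 * δ u 1` nonnegative, while `b 1 - y 1 = -(b 0 - y 0)`; hence `y
= b`. The differences `c - d` then have one sign and a vanishing sum, so each tends to `0`. -/
theorem tendsto_of_stationary (S : ThresholdSystem p γ α n a c) (hp : ∀ k, 0 < p k) {P : ℝ}
    (hP : ∀ k, p k ≤ P) (hP1 : P < 1) {b : Fin 2 → ℝ} {d : Fin 2 → ℕ → ℝ}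
    (hb : ∀ k, 0 < b k) (S' : ThresholdSystem p γ α n (fun _ => b) (fun _ => d)) (k : Fin 2) :
    Tendsto (fun t => a t k) atTop (𝓝 (b k)) ∧
      ∀ i, Tendsto (fun u => c u k i) atTop (𝓝 (d k i)) := by
  obtain ⟨x, hx⟩ := S.exists_tendsto (fun k => (hp k).le) hP hP1
  obtain ⟨y, hy, hy0, hy1⟩ : ∃ y : Fin 2 → ℝ, (∀ k, Tendsto (fun t => a t k) atTop (𝓝 (y k))) ∧
      y 0 = x ∧ y 1 = α - x := by
    refine ⟨![x, α - x], fun k => ?_, rfl, rfl⟩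
    fin_cases k
    · exact hx
    · refine (hx.const_sub α).congr fun t => ?_
      change α - a t 0 = a t 1
      linarith [S.sum_eq t]
  have hynn : ∀ k, 0 ≤ y k := fun k => ge_of_tendsto' (hy k) fun t => S.nonneg t k
  set τ : Fin 2 → ℝ := fun k => ∑ i ∈ Finset.range n, d k (i + 1) with hτ
  have hτ0 : ∀ k, 0 ≤ τ k := fun k => Finset.sum_nonneg fun i _ => (S'.shaped 0).nonneg k _
  have hγ : ∀ k, γ k = b k * (1 + p k * τ k) := fun k => by
    have := S'.balance 0 k
    rw [← Finset.sum_mul] at this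
    rw [this, hτ]
    ring
  set δ : ℕ → Fin 2 → ℝ :=
    fun u k => p k * y k * ∑ i ∈ Finset.range n, (c u k (i + 1) - d k (i + 1)) with hδ
  have hlim : ∀ k, Tendsto (fun u => δ u k) atTop (𝓝 ((b k - y k) * (1 + p k * τ k))) := by
    intro k
    have h1 := (S.tendsto_sum (hy k)).sub_const (p k * y k * τ k)
    rw [hγ k] at h1
    convert h1 using 1
    · funext u
      simp only [hδ, hτ, Finset.sum_sub_distrib, Finset.mul_sum, mul_sub]
      congr 1
      refine Finset.sum_congr rfl fun i _ => ?_
      ring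
    · congr 1
      ring
  have hpy : ∀ k, 0 ≤ p k * y k := fun k => mul_nonneg (hp k).le (hynn k)
  have hmul : ∀ u, 0 ≤ δ u 0 * δ u 1 := by
    intro u
    rcases (S.shaped u).le_total (S'.shaped 0) with h | h
    · exact mul_nonneg_of_nonpos_of_nonpos
        (mul_nonpos_of_nonneg_of_nonpos (hpy 0)
          (Finset.sum_nonpos fun i _ => sub_nonpos.2 (h 0 (i + 1))))
        (mul_nonpos_of_nonneg_of_nonpos (hpy 1)
          (Finset.sum_nonpos fun i _ => sub_nonpos.2 (h 1 (i + 1))))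
    · exact mul_nonneg
        (mul_nonneg (hpy 0) (Finset.sum_nonneg fun i _ => sub_nonneg.2 (h 0 (i + 1))))
        (mul_nonneg (hpy 1) (Finset.sum_nonneg fun i _ => sub_nonneg.2 (h 1 (i + 1))))
  have hge : 0 ≤ ((b 0 - y 0) * (1 + p 0 * τ 0)) * ((b 1 - y 1) * (1 + p 1 * τ 1)) :=
    ge_of_tendsto' ((hlim 0).mul (hlim 1)) hmul
  have hτpos : ∀ k, 0 < 1 + p k * τ k := fun k => by
    have := mul_nonneg (hp k).le (hτ0 k)
    linarith
  have hsum := S'.sum_eq 0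
  have h10 : b 1 - y 1 = -(b 0 - y 0) := by
    rw [hy0, hy1]; linarith
  have h0 : b 0 - y 0 = 0 := by
    rw [h10] at hge
    have h1 := mul_pos (hτpos 0) (hτpos 1)
    by_contra hne
    have h2 : 0 < (b 0 - y 0) ^ 2 := by positivity
    nlinarith [mul_pos h1 h2]
  have hby : ∀ k, b k = y k := fun k => by
    fin_cases k
    · exact sub_eq_zero.1 h0
    · rw [h0, neg_zero] at h10
      exact sub_eq_zero.1 h10
  refine ⟨hby k ▸ hy k, fun i => ?_⟩
  rcases i.eq_zero_or_pos with rfl | hi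
  · simp only [(S.shaped _).zero, (S'.shaped 0).zero]
    exact tendsto_const_nhds
  rcases lt_or_ge n i with hin | hin
  · simp only [(S.shaped _).top k i hin, (S'.shaped 0).top k i hin]
    exact tendsto_const_nhds
  obtain ⟨j, rfl⟩ : ∃ j, i = j + 1 := ⟨i - 1, by omega⟩
  have hpy0 : 0 < p k * y k := mul_pos (hp k) (hby k ▸ hb k)
  have h1 : Tendsto (fun u => ∑ i ∈ Finset.range n, (c u k (i + 1) - d k (i + 1))) atTop
      (𝓝 0) := by
    have h2 := (hlim k).div_const (p k * y k)
    rw [hby k, sub_self, zero_mul, zero_div] at h2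
    refine h2.congr fun u => ?_
    exact mul_div_cancel_left₀ _ hpy0.ne'
  rw [← tendsto_sub_nhds_zero_iff]
  refine squeeze_zero_norm (fun u => ?_) (tendsto_zero_iff_abs_tendsto_zero _ |>.1 h1)
  have hj : j ∈ Finset.range n := Finset.mem_range.2 (by omega)
  rw [Real.norm_eq_abs, Function.comp_apply]
  rcases (S.shaped u).le_total (S'.shaped 0) with h | h
  · have h2 := Finset.single_le_sum (f := fun i => d k (i + 1) - c u k (i + 1))
      (fun i _ => sub_nonneg.2 (h k (i + 1))) hj
    rw [← abs_neg, neg_sub, ← abs_neg (∑ _ ∈ _, _), ← Finset.sum_neg_distrib]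
    simp only [neg_sub]
    exact abs_le_abs_of_nonneg (sub_nonneg.2 (h k (j + 1))) h2
  · have h2 := Finset.single_le_sum (f := fun i => c u k (i + 1) - d k (i + 1))
      (fun i _ => sub_nonneg.2 (h k (i + 1))) hj
    exact abs_le_abs_of_nonneg (sub_nonneg.2 (h k (j + 1))) h2

end ThresholdSystem

/-! ### Convergence of the fluid trajectories -/

section Convergence

variable {p γ : Fin 2 → ℝ} {α : ℝ} {n : ℕ} {z s : ℕ → Profile}

lemma IsFluidTrajectory.mass_eq (H : Regime p γ α n) (h : IsFluidTrajectory p γ α z s)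
    (hv : ∀ t k j, n < j → idle (z t) (s t) k j = 0) (t : ℕ) (k : Fin 2) :
    γ k = scheduled (s t) k + ∑ i ∈ Finset.range n, idle (z t) (s t) k (i + 1) := by
  have h1 := (h.2 t).1.1.hasSum_idle (h.isState H t) k
  have h2 : HasSum (idle (z t) (s t) k) (∑ i ∈ Finset.range (n + 1), idle (z t) (s t) k i) :=
    hasSum_sum_of_ne_finset_zero fun i hi => hv t k i (by
      rw [Finset.mem_range] at hi; omega)
  rw [Finset.sum_range_succ', (h.2 t).1.1.idle_eq_zero (h.isState H t), add_zero] at h2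
  linarith [h1.unique h2]

/-- In the next slot at most `p k * scheduled (s t) k` is idle at age `1`, and at most the present
idle mass at later ages. -/
lemma IsFluidTrajectory.mul_scheduled_le (H : Regime p γ α n) (h : IsFluidTrajectory p γ α z s)
    (hv : ∀ t k j, n < j → idle (z t) (s t) k j = 0) (t : ℕ) (k : Fin 2) :
    (1 - p k) * scheduled (s t) k ≤ scheduled (s (t + 1)) k := by
  have h1 := h.mass_eq H hv t k
  have h2 := h.mass_eq H hv (t + 1) k
  have h3 : ∑ i ∈ Finset.range n, idle (z (t + 1)) (s (t + 1)) k (i + 1) =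
      ∑ i ∈ Finset.range (n + 1), idle (z (t + 1)) (s (t + 1)) k (i + 1) := by
    rw [Finset.sum_range_succ, hv (t + 1) k (n + 1) (by omega), add_zero]
  rw [h3, Finset.sum_range_succ'] at h2
  have h4 := h.idle_le H t k le_rfl H.one_le
  have h5 : ∑ i ∈ Finset.range n, idle (z (t + 1)) (s (t + 1)) k (i + 1 + 1) ≤
      ∑ i ∈ Finset.range n, idle (z t) (s t) k (i + 1) :=
    Finset.sum_le_sum fun i hi =>
      h.idle_succ_le H t k (by omega) (by have := Finset.mem_range.1 hi; omega)
  rw [zero_add] at h2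
  linarith

/-- Positivity persists. If it failed at slot `n` it would have failed in all earlier slots, the
idle ages `1, …, n` would be empty, and the class would have no mass. -/
lemma IsFluidTrajectory.scheduled_pos (H : Regime p γ α n) (h : IsFluidTrajectory p γ α z s)
    (hv : ∀ t k j, n < j → idle (z t) (s t) k j = 0) {t : ℕ} (ht : n ≤ t) (k : Fin 2) :
    0 < scheduled (s t) k := by
  have hstep := fun t => h.mul_scheduled_le H hv t k
  have hp : 0 < 1 - p k := by linarith [H.p_lt_one k]
  have hle : ∀ i j, 0 < scheduled (s i) k → 0 < scheduled (s (i + j)) k := by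
    intro i j hi
    induction j with
    | zero => exact hi
    | succ j ih => exact (mul_pos hp ih).trans_le (hstep _)
  obtain ⟨j, rfl⟩ := Nat.exists_eq_add_of_le ht
  refine hle n j ?_
  by_contra hneg
  have hzero : ∀ i ≤ n, scheduled (s i) k = 0 := by
    intro i hi
    refine le_antisymm ?_ (scheduled_nonneg (h.2 i).1.1 k)
    by_contra! hpos
    obtain ⟨l, rfl⟩ := Nat.exists_eq_add_of_le hi
    exact hneg (hle i l hpos)
  have h1 := h.mass_eq H hv n k
  have h2 : ∑ i ∈ Finset.range n, idle (z n) (s n) k (i + 1) ≤ 0 := by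
    refine Finset.sum_nonpos fun i hi => ?_
    have hi := Finset.mem_range.1 hi
    have h3 := h.idle_le H (n - (i + 1)) k (i := i + 1) (by omega) (by omega)
    rwa [Nat.sub_add_cancel (by omega), hzero _ (by omega), mul_zero] at h3
  have := H.mass_pos k
  have := hzero n le_rfl
  linarith

/-- The idle fraction in slot `u + n` among the users that returned to age `1` together. -/
noncomputable def idleFraction (p : Fin 2 → ℝ) (n : ℕ) (z s : ℕ → Profile) (u : ℕ) (k : Fin 2)
    (i : ℕ) : ℝ :=
  if i = 0 then 1 else idle (z (u + n)) (s (u + n)) k i / (p k * scheduled (s (u + n - i)) k)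

lemma IsFluidTrajectory.idle_eq (H : Regime p γ α n) (hs : ∀ t k, 0 < scheduled (s t) k)
    (u : ℕ) (k : Fin 2) {i : ℕ} (hi : 1 ≤ i) :
    idle (z (u + n)) (s (u + n)) k i =
      idleFraction p n z s u k i * (p k * scheduled (s (u + n - i)) k) := by
  rw [idleFraction, if_neg (by omega), div_mul_cancel₀]
  exact (mul_pos (H.p_pos k) (hs _ k)).ne'

lemma IsFluidTrajectory.thresholdSystem (H : Regime p γ α n) (h : IsFluidTrajectory p γ α z s)
    (hv : ∀ t k j, n < j → idle (z t) (s t) k j = 0) (hs : ∀ t k, 0 < scheduled (s t) k) :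
    ThresholdSystem p γ α n (fun t => scheduled (s t)) (idleFraction p n z s) := by
  have hpos : ∀ t k, 0 < p k * scheduled (s t) k := fun t k => mul_pos (H.p_pos k) (hs t k)
  have htop : ∀ u k i, n < i → idleFraction p n z s u k i = 0 := fun u k i hi => by
    rw [idleFraction, if_neg (by omega), hv _ _ _ hi, zero_div]
  have hone : ∀ u k i, idleFraction p n z s u k i ≤ 1 := fun u k i => by
    by_cases hi : i = 0
    · rw [idleFraction, if_pos hi]
    rcases lt_or_ge n i with hin | hin
    · rw [htop u k i hin]; exact zero_le_one
    · rw [idleFraction, if_neg hi]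
      refine div_le_one_of_le₀ ?_ (hpos _ k).le
      have := h.idle_le H (u + n - i) k (i := i) (by omega) hin
      rwa [Nat.sub_add_cancel (by omega)] at this
  refine ⟨fun t k => (hs t k).le, fun t => ?_, fun u => ⟨fun k i => ?_, hone u,
    fun k => if_pos rfl, htop u, ?_⟩, fun u k i => ?_, fun u k => ?_⟩
  · have := (h.2 t).1.2.1
    rwa [Fin.sum_univ_two] at this
  · rw [idleFraction]
    split_ifs
    · exact zero_le_one
    · exact div_nonneg (h.idle_nonneg _ k i) (hpos _ k).le
  · intro k i m j hi hj hr hc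
    have hin : i ≤ n := by
      by_contra! hin
      rw [htop u k i hin] at hc
      exact lt_irrefl _ hc
    rw [idleFraction, if_neg (by omega), div_pos_iff_of_pos_right (hpos _ k)] at hc
    have hk := k.isLt
    have hm := m.isLt
    have hρ : rank k i ≤ 2 * n + 3 := by simp only [rank]; omega
    have hjn : j ≤ n := by simp only [rank] at hr; omega
    have h1 := h.apply_eq H (u + n - j) hρ hj hr
    rw [Nat.sub_add_cancel (by omega)] at h1
    have h2 := h1 ⟨k, i, hi, le_rfl, hc⟩
    rw [idleFraction, if_neg (by omega), idle, h2.1, h2.2, sub_zero, div_self (hpos _ m).ne']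
  · rcases i.eq_zero_or_pos with rfl | hi
    · exact (hone (u + 1) k 1).trans_eq (if_pos rfl).symm
    rcases lt_or_ge n i with hin | hin
    · rw [htop u k i hin, htop _ k _ (by omega)]
    · rw [idleFraction, if_neg (by omega), idleFraction, if_neg (by omega),
        show u + 1 + n - (i + 1) = u + n - i by omega, show u + 1 + n = u + n + 1 by ring]
      exact div_le_div_of_nonneg_right (h.idle_succ_le H (u + n) k hi hin) (hpos _ k).le
  · rw [Finset.mul_sum, h.mass_eq H hv (u + n) k]
    congr 1
    refine Finset.sum_congr rfl fun i _ => ?_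
    rw [IsFluidTrajectory.idle_eq H hs u k (by omega)]
    ring

/-- Every fluid trajectory converges to any fixed point. -/
theorem IsFluidTrajectory.tendsto (H : Regime p γ α n) (h : IsFluidTrajectory p γ α z s)
    {x y : Profile} (hx : IsFluidTrajectory p γ α (fun _ => x) (fun _ => y)) (k : Fin 2) :
    Tendsto (fun t => scheduled (s t) k) atTop (𝓝 (scheduled y k)) ∧
      ∀ i, Tendsto (fun t => z t k i) atTop (𝓝 (x k i)) := by
  have hxv : ∀ (t : ℕ) k j, n < j → idle x y k j = 0 := fun _ k j hj =>
    hx.idle_eq_zero_of_lt H le_rfl hj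
  have hxs : ∀ (t : ℕ) k, 0 < scheduled y k := fun _ k => hx.scheduled_pos H hxv le_rfl k
  wlog hgood : (∀ t k j, n < j → idle (z t) (s t) k j = 0) ∧ ∀ t k, 0 < scheduled (s t) k
    generalizing z s
  -- The first `n` slots remove idle mass beyond age `n`, the next `n` make the scheduled
  -- proportions positive.
  · have h1 : ∀ t k j, n < j → idle (z (t + n)) (s (t + n)) k j = 0 := fun t k j hj =>
      h.idle_eq_zero_of_lt H (by omega) hj
    have h2 := this (h.shift H (n + n)) ⟨fun t k j hj => by
      have h3 := h1 (t + n) k j hj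
      rwa [add_assoc] at h3, fun t k => by
      have h3 := (h.shift H n).scheduled_pos H h1 (t := t + n) (by omega) k
      rwa [add_assoc] at h3⟩
    exact ⟨(tendsto_add_atTop_iff_nat (n + n)).1 h2.1,
      fun i => (tendsto_add_atTop_iff_nat (n + n)).1 (h2.2 i)⟩
  obtain ⟨hv, hs⟩ := hgood
  have S := h.thresholdSystem H hv hs
  have S' := hx.thresholdSystem H hxv hxs
  have key := S.tendsto_of_stationary H.p_pos H.p_le H.lt_one (hxs 0) S' k
  refine ⟨key.1, ?_⟩
  have hidle : ∀ i, 1 ≤ i → Tendsto (fun t => idle (z t) (s t) k i) atTop (𝓝 (idle x y k i)) := by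
    intro i hi
    rw [← tendsto_add_atTop_iff_nat n]
    rcases lt_or_ge n i with hin | hin
    · simp only [hv _ _ _ hin, hxv 0 k i hin]
      exact tendsto_const_nhds
    have h1 : Tendsto (fun u => scheduled (s (u + n - i)) k) atTop (𝓝 (scheduled y k)) :=
      key.1.comp (tendsto_atTop_mono (fun u => show u ≤ u + n - i by omega) tendsto_id)
    have h2 := (key.2 i).mul (h1.const_mul (p k))
    have h3 := IsFluidTrajectory.idle_eq (z := fun _ => x) H hxs 0 k hi
    rw [h3]
    refine h2.congr fun u => ?_
    rw [← IsFluidTrajectory.idle_eq H hs u k hi]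
  intro i
  induction i with
  | zero =>
    simp only [((h.isState H _) k).1, ((hx.isState H 0) k).1]
    exact tendsto_const_nhds
  | succ i ih =>
    rw [← tendsto_add_atTop_iff_nat 1]
    rcases i.eq_zero_or_pos with rfl | hi
    · simp only [zero_add, h.apply_one, hx.apply_one 0]
      exact key.1.const_mul _
    · have h1 := (ih.const_mul (1 - p k)).add ((hidle i hi).const_mul (p k))
      convert h1 using 1
      · funext t
        rw [h.apply_succ t k hi, idle]
        ring
      · rw [hx.apply_succ 0 k hi, idle]
        congr 1
        ring

lemma IsFixedPoint.isFluidTrajectory {x y : Profile} (hx : IsState γ x)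
    (hy : IsWhittleSchedule p α x y) (h : next p x y = x) :
    IsFluidTrajectory p γ α (fun _ => x) (fun _ => y) :=
  ⟨hx, fun _ => ⟨hy, h.symm⟩⟩

lemma IsFixedPoint.eq (H : Regime p γ α n) {x x' : Profile} (hx : IsFixedPoint p γ α x)
    (hx' : IsFixedPoint p γ α x') : x = x' := by
  obtain ⟨h1, y, h2, h3⟩ := hx
  obtain ⟨h1', y', h2', h3'⟩ := hx'
  funext k i
  exact tendsto_nhds_unique tendsto_const_nhds
    (((IsFixedPoint.isFluidTrajectory h1 h2 h3).tendsto H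
      (IsFixedPoint.isFluidTrajectory h1' h2' h3') k).2 i)

end Convergence

/-! ### Stationary laws of threshold policies -/

lemma HasSum.of_eq {f g : ℕ → ℝ} {a b : ℝ} (h : HasSum f a) (hfg : ∀ i, g i = f i)
    (hab : b = a) : HasSum g b := by
  rwa [hab, funext hfg]

section StationaryAge

variable {q : ℝ} {l : ℕ}

lemma stationary_denom_pos (hq : 0 < q) (hl : 1 ≤ l) : 0 < l * q + 1 - q := by
  have : (1 : ℝ) ≤ l := by exact_mod_cast hl
  nlinarith

lemma stationaryAge_nonneg (hq : 0 < q) (hq1 : q < 1) (hl : 1 ≤ l) (i : ℕ) :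
    0 ≤ stationaryAge q l i := by
  rw [stationaryAge]
  split_ifs
  · exact le_rfl
  · exact mul_nonneg (pow_nonneg (by linarith) _)
      (div_nonneg hq.le (stationary_denom_pos hq hl).le)

lemma stationaryAge_of_le {i : ℕ} (hi : 1 ≤ i) (hil : i ≤ l) :
    stationaryAge q l i = q / (l * q + 1 - q) := by
  rw [stationaryAge, if_neg (by omega), Nat.sub_eq_zero_of_le hil, pow_zero, one_mul]

lemma stationaryAge_add (hl : 1 ≤ l) (i : ℕ) :
    stationaryAge q l (l + i) = (1 - q) ^ i * (q / (l * q + 1 - q)) := by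
  rw [stationaryAge, if_neg (by omega), Nat.add_sub_cancel_left]

lemma stationaryAge_succ {i : ℕ} (hi : 1 ≤ i) :
    stationaryAge q l (i + 1) =
      stationaryAge q l i - q * if l ≤ i then stationaryAge q l i else 0 := by
  rw [stationaryAge, stationaryAge, if_neg (by omega), if_neg (by omega)]
  split_ifs with h
  · rw [Nat.succ_sub h, pow_succ]; ring
  · rw [Nat.sub_eq_zero_of_le (show i + 1 ≤ l by omega), Nat.sub_eq_zero_of_le (by omega)]; ring

lemma hasSum_stationaryAge_add (hq : 0 < q) (hq1 : q < 1) (hl : 1 ≤ l) :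
    HasSum (fun i => stationaryAge q l (l + i)) (1 / (l * q + 1 - q)) := by
  simp only [stationaryAge_add hl]
  have h := (hasSum_geometric_of_lt_one (show 0 ≤ 1 - q by linarith)
    (show 1 - q < 1 by linarith)).mul_right (q / (l * q + 1 - q))
  refine HasSum.of_eq h (fun _ => rfl) ?_
  rw [sub_sub_cancel]
  field_simp

lemma hasSum_stationaryAge (hq : 0 < q) (hq1 : q < 1) (hl : 1 ≤ l) :
    HasSum (stationaryAge q l) 1 := by
  rw [← hasSum_nat_add_iff' l]
  have h := hasSum_stationaryAge_add hq hq1 hl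
  simp only [add_comm l] at h
  refine HasSum.of_eq h (fun _ => rfl) ?_
  obtain ⟨m, rfl⟩ := Nat.exists_eq_add_of_le' hl
  have hd := (stationary_denom_pos hq hl).ne'
  have h0 : ∀ i ∈ Finset.range m, stationaryAge q (m + 1) (i + 1) =
      q / ((m + 1 : ℕ) * q + 1 - q) := fun i hi =>
    stationaryAge_of_le (by omega) (by have := Finset.mem_range.1 hi; omega)
  rw [Finset.sum_range_succ', Finset.sum_congr rfl h0, Finset.sum_const, Finset.card_range,
    nsmul_eq_mul, stationaryAge, if_pos rfl]
  rw [show ((m + 1 : ℕ) : ℝ) * q + 1 - q = m * q + 1 by push_cast; ring] at hd ⊢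
  field_simp
  ring

lemma hasSum_stationaryAge_scheduled (hq : 0 < q) (hq1 : q < 1) (hl : 1 ≤ l) :
    HasSum (fun i => if l ≤ i then stationaryAge q l i else 0) (1 / (l * q + 1 - q)) := by
  rw [← hasSum_nat_add_iff' l]
  have h := hasSum_stationaryAge_add hq hq1 hl
  refine HasSum.of_eq h (fun i => ?_) ?_
  · rw [if_pos (by omega), add_comm]
  · rw [Finset.sum_eq_zero, sub_zero]
    intro i hi
    rw [if_neg (by have := Finset.mem_range.1 hi; omega)]

lemma hasSum_mul_stationaryAge (hq : 0 < q) (hq1 : q < 1) (hl : 1 ≤ l) :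
    HasSum (fun i : ℕ => i * stationaryAge q l i)
      ((whittleIndex q l + 1 / q - 1) / (l * q + 1 - q)) := by
  rw [← hasSum_nat_add_iff' l]
  have hr : ‖1 - q‖ < 1 := by
    rw [Real.norm_eq_abs, abs_lt]; constructor <;> linarith
  have hd := (stationary_denom_pos hq hl).ne'
  have h := (((hasSum_coe_mul_geometric_of_norm_lt_one hr).mul_right (q / (l * q + 1 - q))).add
    ((hasSum_stationaryAge_add hq hq1 hl).mul_left (l : ℝ)))
  refine HasSum.of_eq h (fun i => ?_) ?_
  · rw [add_comm i l, stationaryAge_add hl]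
    push_cast
    ring
  · have h0 : ∀ i ∈ Finset.range l, (i : ℝ) * stationaryAge q l i =
        i * (q / (l * q + 1 - q)) := fun i hi => by
      rcases i.eq_zero_or_pos with rfl | h1
      · simp
      · rw [stationaryAge_of_le h1 (Finset.mem_range.1 hi).le]
    have h1 : ∀ m : ℕ, ∑ i ∈ Finset.range m, (i : ℝ) = m * (m - 1) / 2 := fun m => by
      induction m with
      | zero => simp
      | succ m ih => rw [Finset.sum_range_succ, ih]; push_cast; ring
    rw [Finset.sum_congr rfl h0, ← Finset.sum_mul, h1, sub_sub_cancel, whittleIndex]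
    field_simp
    ring

end StationaryAge

/-! ### Threshold mixtures: stationarity and existence -/

section Mixture

variable {p γ : Fin 2 → ℝ} {α : ℝ} {n : ℕ}

lemma Regime.thresholdLoad_eq (H : Regime p γ α n) {l : Fin 2 → ℕ} (hl : ∀ k, 1 ≤ l k) :
    thresholdLoad p γ l = ∑ k, γ k * (1 / (l k * p k + 1 - p k)) :=
  Finset.sum_congr rfl fun k _ => by
    rw [(hasSum_stationaryAge_add (H.p_pos k) (H.p_lt_one k) (hl k)).tsum_eq]

/-- A mixture of two threshold policies at a common index is a fixed point. -/
theorem IsThresholdMixture.isFixedPoint (H : Regime p γ α n) {z : Profile}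
    (h : IsThresholdMixture p γ α z) : IsFixedPoint p γ α z := by
  obtain ⟨m, j, l₁, l₂, θ, hj, hl, h₁, h₂, hθ0, hθ1, hload, hz⟩ := h
  have hu : ∀ l : Fin 2 → ℕ, (∀ k, 1 ≤ l k) → ∀ k i, 0 ≤ stationaryAge (p k) (l k) i :=
    fun l hl k i => stationaryAge_nonneg (H.p_pos k) (H.p_lt_one k) (hl k) i
  have hu₁ := hu l₁ fun k => (hl k).1
  have hu₂ := hu l₂ fun k => (hl k).2
  have hγ := fun k => (H.mass_pos k).le
  have hθ' : 0 ≤ 1 - θ := by linarith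
  set s : Profile := fun k i =>
    γ k * (θ * (if l₁ k ≤ i then stationaryAge (p k) (l₁ k) i else 0) +
      (1 - θ) * (if l₂ k ≤ i then stationaryAge (p k) (l₂ k) i else 0)) with hs
  have hstate : IsState γ z := by
    intro k
    refine ⟨by simp [hz, stationaryAge], fun i => ?_, ?_⟩
    · rw [hz]
      exact mul_nonneg (hγ k)
        (add_nonneg (mul_nonneg hθ0.le (hu₁ k i)) (mul_nonneg hθ' (hu₂ k i)))
    · have := (((hasSum_stationaryAge (H.p_pos k) (H.p_lt_one k) (hl k).1).mul_left θ).add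
        ((hasSum_stationaryAge (H.p_pos k) (H.p_lt_one k) (hl k).2).mul_left (1 - θ))).mul_left
          (γ k)
      exact HasSum.of_eq this (hz k) (by ring)
  have hsum : ∀ k, HasSum (s k) (γ k * (θ * (1 / (l₁ k * p k + 1 - p k)) +
      (1 - θ) * (1 / (l₂ k * p k + 1 - p k)))) := fun k =>
    (((hasSum_stationaryAge_scheduled (H.p_pos k) (H.p_lt_one k) (hl k).1).mul_left θ).add
      ((hasSum_stationaryAge_scheduled (H.p_pos k) (H.p_lt_one k) (hl k).2).mul_left
        (1 - θ))).mul_left (γ k)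
  have hadm : IsAdmissible z s := by
    intro k i
    have e₁ : 0 ≤ (if l₁ k ≤ i then stationaryAge (p k) (l₁ k) i else 0) ∧
        (if l₁ k ≤ i then stationaryAge (p k) (l₁ k) i else 0) ≤ stationaryAge (p k) (l₁ k) i := by
      split_ifs
      · exact ⟨hu₁ k i, le_rfl⟩
      · exact ⟨le_rfl, hu₁ k i⟩
    have e₂ : 0 ≤ (if l₂ k ≤ i then stationaryAge (p k) (l₂ k) i else 0) ∧
        (if l₂ k ≤ i then stationaryAge (p k) (l₂ k) i else 0) ≤ stationaryAge (p k) (l₂ k) i := by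
      split_ifs
      · exact ⟨hu₂ k i, le_rfl⟩
      · exact ⟨le_rfl, hu₂ k i⟩
    rw [hz]
    exact ⟨mul_nonneg (hγ k) (add_nonneg (mul_nonneg hθ0.le e₁.1) (mul_nonneg hθ' e₂.1)),
      mul_le_mul_of_nonneg_left (add_le_add (mul_le_mul_of_nonneg_left e₁.2 hθ0.le)
        (mul_le_mul_of_nonneg_left e₂.2 hθ')) (hγ k)⟩
  refine ⟨hstate, s, ⟨hadm, ?_, ?_⟩, ?_⟩
  · rw [← hload, H.thresholdLoad_eq fun k => (hl k).1, H.thresholdLoad_eq fun k => (hl k).2,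
      Finset.mul_sum, Finset.mul_sum, ← Finset.sum_add_distrib]
    refine Finset.sum_congr rfl fun k _ => ?_
    rw [scheduled, (hsum k).tsum_eq]
    ring
  · intro k i m' j' hi hj' hlow hpos
    -- Strictly below `(m, j)` both thresholds leave users idle; strictly above, both schedule
    -- everything. Only ties with `(m, j)` are served partially.
    have hi₂ : ¬ LowerPriority p k i m j := by
      rw [← h₂ k i hi, not_lt]
      by_contra! hlt
      have hlt₁ : i < l₁ k := by
        rw [h₁ k i hi]
        exact ((h₂ k i hi).1 hlt).not_symm
      simp only [hs, if_neg (not_le.2 hlt), if_neg (not_le.2 hlt₁)] at hpos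
      simp at hpos
    have hlow' := not_lowerPriority_of_not_of_lowerPriority H.p_pos hi hj hi₂ hlow
    have e₁ : l₁ m' ≤ j' := by
      by_contra! hlt
      exact (h₁ m' j' hj').1 hlt hlow'
    have e₂ : l₂ m' ≤ j' := by
      by_contra! hlt
      exact ((h₂ m' j' hj').1 hlt).not_symm hlow'
    simp only [hs, if_pos e₁, if_pos e₂]
    rw [hz]
  · funext k i
    match i with
    | 0 => exact ((hstate k).1).symm
    | 1 =>
      simp only [next]
      rw [scheduled, (hsum k).tsum_eq, hz, stationaryAge_of_le le_rfl (hl k).1,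
        stationaryAge_of_le le_rfl (hl k).2]
      ring
    | i + 2 =>
      simp only [next]
      have e := fun l => stationaryAge_succ (q := p k) (l := l) (i := i + 1) (by omega)
      rw [hz k (i + 2), hz k (i + 1), show i + 2 = i + 1 + 1 from rfl, e, e]
      simp only [hs]
      ring

lemma Regime.lowerPriority_iff (H : Regime p γ α n) {k m : Fin 2} {i j : ℕ} (hi : 1 ≤ i)
    (hj : 1 ≤ j) (hjn : j ≤ n) :
    (LowerPriority p k i m j ↔ rank k i < rank m j) ∧
      (LowerPriority p m j k i ↔ rank m j < rank k i) := by
  have hk := k.isLt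
  have hm := m.isLt
  have h₁ : rank k i < rank m j → LowerPriority p k i m j := fun h =>
    H.lowerPriority hi (by simp only [rank] at h; omega) h
  have h₂ : rank m j < rank k i → LowerPriority p m j k i := fun h =>
    H.lowerPriority hj (by omega) h
  have h₃ : rank k i = rank m j → ¬ LowerPriority p k i m j ∧ ¬ LowerPriority p m j k i := by
    intro h
    obtain ⟨rfl, rfl⟩ := rank_injective hi hj h
    exact ⟨fun h => h.not_symm h, fun h => h.not_symm h⟩
  rcases lt_trichotomy (rank k i) (rank m j) with h | h | h
  · exact ⟨⟨fun _ => h, h₁⟩, ⟨fun h' => absurd (h₁ h) h'.not_symm, h₂⟩⟩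
  · exact ⟨⟨fun h' => absurd h' (h₃ h).1, h₁⟩, ⟨fun h' => absurd h' (h₃ h).2, h₂⟩⟩
  · exact ⟨⟨fun h' => absurd (h₂ h) h'.not_symm, h₁⟩, ⟨fun _ => h, h₂⟩⟩

lemma exists_convex_comb {x y α : ℝ} (hx : x ≤ α) (hy : α < y) :
    ∃ θ : ℝ, 0 < θ ∧ θ ≤ 1 ∧ θ * x + (1 - θ) * y = α := by
  have h : 0 < y - x := by linarith
  refine ⟨(y - α) / (y - x), div_pos (by linarith) h, (div_le_one h).2 (by linarith), ?_⟩
  field_simp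
  ring

lemma Regime.isThresholdMixture (H : Regime p γ α n) {m : Fin 2} {j : ℕ} (hj : 1 ≤ j)
    (hjn : j ≤ n) {l₁ l₂ : Fin 2 → ℕ} (hl : ∀ k, 1 ≤ l₁ k ∧ 1 ≤ l₂ k)
    (h₁ : ∀ k i, 1 ≤ i → (i < l₁ k ↔ rank k i ≤ rank m j))
    (h₂ : ∀ k i, 1 ≤ i → (i < l₂ k ↔ rank k i < rank m j))
    (hle : thresholdLoad p γ l₁ ≤ α) (hlt : α < thresholdLoad p γ l₂) :
    ∃ z, IsThresholdMixture p γ α z := by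
  obtain ⟨θ, h0, h1, hθ⟩ := exists_convex_comb hle hlt
  refine ⟨_, m, j, l₁, l₂, θ, hj, hl, fun k i hi => ?_, fun k i hi => ?_, h0, h1, hθ,
    fun k i => rfl⟩
  · rw [h₁ k i hi, (H.lowerPriority_iff hi hj hjn).2, not_lt]
  · rw [h₂ k i hi, (H.lowerPriority_iff hi hj hjn).1]

/-- The load is `1 > α` at threshold `1` and at most `α` at `n + 1` by `overload`, so it passes `α`
at some age `j ≤ n`. -/
theorem Regime.exists_isThresholdMixture (H : Regime p γ α n) :
    ∃ z, IsThresholdMixture p γ α z := by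
  classical
  have hload : thresholdLoad p γ (fun _ => n + 1) ≤ α := by
    rw [H.thresholdLoad_eq fun k => by omega]
    have hn : (0 : ℝ) ≤ n := by positivity
    have h1 : ∀ k, γ k * (1 / ((n + 1 : ℕ) * p k + 1 - p k)) ≤ γ k * α := by
      intro k
      refine mul_le_mul_of_nonneg_left ?_ (H.mass_pos k).le
      rw [div_le_iff₀ (stationary_denom_pos (H.p_pos k) (by omega))]
      have h2 := H.overload
      have h3 : n * p 1 * α ≤ n * p k * α :=
        mul_le_mul_of_nonneg_right (mul_le_mul_of_nonneg_left (H.le_p k) hn) H.budget_pos.le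
      push_cast
      linarith
    refine (Finset.sum_le_sum fun k _ => h1 k).trans_eq ?_
    rw [← Finset.sum_mul, Fin.sum_univ_two, H.mass_sum, one_mul]
  have hex : ∃ j : ℕ, thresholdLoad p γ (fun _ => j + 1) ≤ α := ⟨n, hload⟩
  have hn : Nat.find hex ≤ n := Nat.find_min' hex hload
  have hspec := Nat.find_spec hex
  have hmin := fun j => Nat.find_min hex (m := j)
  set j := Nat.find hex
  have hone : thresholdLoad p γ (fun _ => 1) = 1 := by
    rw [H.thresholdLoad_eq fun k => le_rfl, Fin.sum_univ_two]
    simp [H.mass_sum]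
  have hj : 1 ≤ j := by
    by_contra hj
    obtain hj : j = 0 := by omega
    rw [hj, zero_add, hone] at hspec
    linarith [H.budget_lt]
  have hlt : α < thresholdLoad p γ (fun _ => j) := by
    have := hmin (j - 1) (by omega)
    rwa [Nat.sub_add_cancel hj, not_le] at this
  -- Between the thresholds `(j, j)` and `(j + 1, j + 1)` lies `(j, j + 1)`, since class 2 comes
  -- first at age `j`. Its load decides which class is mixed.
  rcases le_or_gt (thresholdLoad p γ (fun k => j + k)) α with h | h
  · refine H.isThresholdMixture (m := 1) hj hn (fun k => ⟨?_, hj⟩) (fun k i hi => ?_)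
      (fun k i hi => ?_) h hlt
    · omega
    · have := k.isLt
      simp only [rank, Fin.val_one]
      omega
    · have := k.isLt
      simp only [rank, Fin.val_one]
      omega
  · refine H.isThresholdMixture (m := 0) hj hn (fun k => ⟨?_, ?_⟩) (fun k i hi => ?_)
      (fun k i hi => ?_) hspec h
    · omega
    · omega
    · have := k.isLt
      simp only [rank, Fin.val_zero]
      omega
    · have := k.isLt
      simp only [rank, Fin.val_zero]
      omega

end Mixture

/-! ### Optimality for the relaxed problem -/

/-- Optimal long-run cost of a user whose transmissions are charged `r`, when the threshold `l` is
optimal. -/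
noncomputable def gain (q r : ℝ) (l : ℕ) : ℝ := (r + whittleIndex q l + 1 / q - 1) / (l * q + 1 - q)

/-- Relative value function of the threshold policy `l` with long-run cost `g`. -/
noncomputable def bias (q g : ℝ) (l i : ℕ) : ℝ :=
  if i ≤ l then ((i : ℝ) - 1) * g - i * (i - 1) / 2
  else ((l : ℝ) - 1) * g - l * (l - 1) / 2 + (i - l) / q

section Bias

variable {q r : ℝ} {l : ℕ}

lemma bias_one (g : ℝ) (hl : 1 ≤ l) : bias q g l 1 = 0 := by simp [bias, hl]

lemma bias_succ_of_lt (g : ℝ) {i : ℕ} (hi : i < l) :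
    bias q g l (i + 1) = bias q g l i + g - i := by
  rw [bias, bias, if_pos (by omega), if_pos (by omega)]
  push_cast
  ring

lemma bias_of_ge (g : ℝ) {i : ℕ} (hi : l ≤ i) :
    bias q g l i = ((l : ℝ) - 1) * g - l * (l - 1) / 2 + (i - l) / q := by
  rcases hi.eq_or_lt with rfl | hi
  · rw [bias, if_pos le_rfl]; ring
  · rw [bias, if_neg (by omega)]

lemma mul_bias_of_ge (hq : 0 < q) (hl : 1 ≤ l) {i : ℕ} (hi : l ≤ i) :
    q * bias q (gain q r l) l i = i + r - gain q r l + (1 / q - 1) := by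
  have hg : gain q r l * (l * q + 1 - q) = r + whittleIndex q l + 1 / q - 1 :=
    div_mul_cancel₀ _ (stationary_denom_pos hq hl).ne'
  rw [bias_of_ge _ hi]
  rw [whittleIndex] at hg
  have h1 : q * ((i - l : ℝ) / q) = i - l := mul_div_cancel₀ _ hq.ne'
  linarith

/-- After clearing the denominator the inequality is exactly `r ≤ whittleIndex q l`. It makes idling
suboptimal from age `l` on, where the relative value has slope `1 / q`. -/
lemma gain_le (hq : 0 < q) (hl : 1 ≤ l) (hr : r ≤ whittleIndex q l) :
    gain q r l ≤ l + 1 / q := by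
  rw [gain, div_le_iff₀ (stationary_denom_pos hq hl)]
  have h1 : 1 / q * q = 1 := div_mul_cancel₀ _ hq.ne'
  have h2 : (l + 1 / q) * (l * q + 1 - q) =
      l * (l * q) + l - l * q + (1 / q * q) * l + 1 / q - 1 / q * q := by ring
  rw [h2, h1]
  rw [whittleIndex] at hr ⊢
  linarith

lemma le_gain (hq : 0 < q) (hl : 1 ≤ l) (hr : whittleIndex q l ≤ r) :
    l + 1 / q ≤ gain q r (l + 1) := by
  rw [gain, le_div_iff₀ (stationary_denom_pos hq (by omega))]
  have h1 : 1 / q * q = 1 := div_mul_cancel₀ _ hq.ne'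
  have h2 : (l + 1 / q) * ((l + 1 : ℕ) * q + 1 - q) =
      l * (l * q) + l + (1 / q * q) * l + 1 / q := by push_cast; ring
  rw [h2, h1]
  rw [whittleIndex] at hr ⊢
  push_cast
  linarith

lemma gain_le_idle (hq : 0 < q) (hl : 1 ≤ l) (hhi : r ≤ whittleIndex q l) (i : ℕ) :
    gain q r l ≤ i + bias q (gain q r l) l (i + 1) - bias q (gain q r l) l i := by
  rcases lt_or_ge i l with hi | hi
  · rw [bias_succ_of_lt _ hi]; linarith
  · have h1 := gain_le hq hl hhi
    have h2 : (l : ℝ) ≤ i := by exact_mod_cast hi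
    rw [bias_of_ge _ hi, bias_of_ge _ (show l ≤ i + 1 by omega)]
    push_cast
    have h3 : ((i : ℝ) + 1 - l) / q = (i - l) / q + 1 / q := by ring
    linarith

/-- Equality holds from age `l` on. Below `l`, the relative value increases up to `l`, which reduces
the claim to `le_gain` at `l - 1`. -/
lemma gain_le_scheduled (hq : 0 < q) (hq1 : q < 1) (hl : 1 ≤ l)
    (hlo : ∀ i, 1 ≤ i → i < l → whittleIndex q i ≤ r) {i : ℕ} (hi1 : 1 ≤ i) :
    gain q r l ≤ i + r + bias q (gain q r l) l (i + 1) - bias q (gain q r l) l i -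
      q * bias q (gain q r l) l (i + 1) := by
  rcases lt_or_ge i l with hi | hi
  · obtain ⟨m, rfl⟩ := Nat.exists_eq_add_of_le' hl
    have h1 := le_gain hq (by omega) (hlo m (by omega) (by omega))
    have h2 := mul_bias_of_ge (r := r) hq hl le_rfl
    set g := gain q r (m + 1)
    have h3 : bias q g (m + 1) (i + 1) ≤ bias q g (m + 1) (m + 1) := by
      have him : (i : ℝ) ≤ m := by exact_mod_cast Nat.lt_succ_iff.1 hi
      have hq2 : 1 ≤ 1 / q := (one_le_div hq).2 hq1.le
      rw [bias, bias, if_pos (by omega), if_pos le_rfl]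
      push_cast
      nlinarith
    have h4 := mul_le_mul_of_nonneg_left h3 hq.le
    rw [bias_succ_of_lt _ hi] at h4 ⊢
    push_cast at h2
    linarith
  · have h1 := mul_bias_of_ge (r := r) hq hl (show l ≤ i + 1 by omega)
    rw [h1, bias_of_ge _ hi, bias_of_ge _ (show l ≤ i + 1 by omega)]
    push_cast
    have h3 : ((i : ℝ) + 1 - l) / q = (i - l) / q + 1 / q := by ring
    linarith

/-- Truncating and slightly shrinking the relative value function gives a bounded one. -/
lemma truncated_gain_le (hq : 0 < q) (hq1 : q < 1) (hl : 1 ≤ l) (hr : 0 ≤ r)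
    (hlo : ∀ i, 1 ≤ i → i < l → whittleIndex q i ≤ r) (hhi : r ≤ whittleIndex q l)
    {ε : ℝ} (hε : 0 < ε) (hε1 : ε ≤ 1) {B : ℕ} (hBl : l ≤ B) (hBg : gain q r l ≤ B)
    (hBε : 1 / q ≤ ε * B) {i : ℕ} (hi : 1 ≤ i) :
    (1 - ε) * gain q r l ≤ (min i B : ℕ) +
        ((1 - ε) * bias q (gain q r l) l (min (i + 1) B) -
          (1 - ε) * bias q (gain q r l) l (min i B)) ∧
      (1 - ε) * gain q r l ≤ (min i B : ℕ) + r +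
        ((1 - ε) * bias q (gain q r l) l (min (i + 1) B) -
          (1 - ε) * bias q (gain q r l) l (min i B)) -
          q * ((1 - ε) * bias q (gain q r l) l (min (i + 1) B)) := by
  have hε' : 0 ≤ 1 - ε := by linarith
  rcases lt_or_ge i B with hiB | hiB
  · rw [min_eq_left hiB.le, min_eq_left (show i + 1 ≤ B by omega)]
    have h1 := mul_le_mul_of_nonneg_left (gain_le_idle hq hl hhi i) hε'
    have h2 := mul_le_mul_of_nonneg_left (gain_le_scheduled hq hq1 hl hlo hi) hε'
    have h3 : 0 ≤ ε * i := by positivity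
    have h4 : 0 ≤ ε * r := by positivity
    constructor <;> linarith
  -- Past the truncation the relative value stops growing and scheduling falls short by `1 / q - 1`;
  -- the slack `ε * B ≥ 1 / q` gained by shrinking covers this.
  · rw [min_eq_right hiB, min_eq_right (show B ≤ i + 1 by omega)]
    have h1 := mul_bias_of_ge (r := r) hq hl hBl
    have h2 := mul_le_mul_of_nonneg_left hBg hε'
    have h3 : 0 ≤ ε * B := by positivity
    have h4 : 0 ≤ ε * r := by positivity
    have h5 : (0 : ℝ) ≤ 1 / q := by positivity
    have h6 : 0 ≤ ε * (1 / q) := by positivity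
    have h7 : q * ((1 - ε) * bias q (gain q r l) l B) =
        (1 - ε) * (B + r - gain q r l + (1 / q - 1)) := by rw [← h1]; ring
    rw [h7]
    constructor <;> linarith

end Bias

/-! ### Weak duality along feasible trajectories -/

section LowerBound

variable {p γ : Fin 2 → ℝ} {α : ℝ} {n : ℕ}

lemma summable_mul_of_bounded {f y : ℕ → ℝ} {C : ℝ} (hf : ∀ i, |f i| ≤ C) (hy : ∀ i, 0 ≤ y i)
    (hs : Summable y) : Summable fun i => f i * y i :=
  Summable.of_norm_bounded (hs.mul_left C) fun i => by
    rw [Real.norm_eq_abs, abs_mul, abs_of_nonneg (hy i)]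
    exact mul_le_mul_of_nonneg_right (hf i) (hy i)

lemma abs_tsum_mul_le {f y : ℕ → ℝ} {C b : ℝ} (hf : ∀ i, |f i| ≤ C) (hy : ∀ i, 0 ≤ y i)
    (hs : HasSum y b) : |∑' i, f i * y i| ≤ C * b := by
  have h1 := (summable_mul_of_bounded hf hy hs.summable).hasSum
  rw [abs_le]
  constructor
  · rw [← neg_mul]
    refine hasSum_le (fun i => ?_) (hs.mul_left (-C)) h1
    exact mul_le_mul_of_nonneg_right (abs_le.1 (hf i)).1 (hy i)
  · exact hasSum_le (fun i => mul_le_mul_of_nonneg_right (abs_le.1 (hf i)).2 (hy i)) h1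
      (hs.mul_left C)

/-- Bellman inequality along one slot, for one class. -/
lemma bellman_le {y s : Profile} (hy : IsState γ y) (hs : IsAdmissible y s)
    {k : Fin 2} {f h : ℕ → ℝ} {C g r : ℝ} (hp1 : p k ≤ 1)
    (hf : ∀ i, |f i| ≤ C) (hh : ∀ i, |h i| ≤ C)
    (hidle : ∀ i, 1 ≤ i → g ≤ f i + (h (i + 1) - h i))
    (hsched : ∀ i, 1 ≤ i → g ≤ f i + r + (h (i + 1) - h i) + p k * (h 1 - h (i + 1))) :
    g * γ k ≤ ∑' i, f i * y k i + r * scheduled s k +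
      (∑' i, h i * next p y s k i - ∑' i, h i * y k i) := by
  have hyk := (hy k).2.2
  have hsk := hs.hasSum hy k
  have hd : ∀ i, 0 ≤ y k i - p k * s k i := fun i => by
    have h1 := hs k i
    have : p k * s k i ≤ s k i := mul_le_of_le_one_left h1.1 hp1
    linarith
  have hnext : HasSum (fun i => h i * next p y s k i)
      (h 1 * (p k * scheduled s k) + ∑' i, h (i + 1) * (y k i - p k * s k i)) := by
    have h1 := (summable_mul_of_bounded (f := fun i => h (i + 1)) (fun i => hh (i + 1)) hd
      (hyk.summable.sub (hsk.summable.mul_left (p k)))).hasSum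
    rw [← hasSum_nat_add_iff' 1] at h1
    rw [← hasSum_nat_add_iff' 2]
    refine HasSum.of_eq h1 (fun i => rfl) ?_
    simp [Finset.sum_range_succ, AgeFluid.next, (hy k).1, hs.eq_zero hy]
  rw [hnext.tsum_eq]
  have s1 := (summable_mul_of_bounded hf (hy k).2.1 hyk.summable).hasSum
  have s2 := (summable_mul_of_bounded hh (hy k).2.1 hyk.summable).hasSum
  have s3 := (summable_mul_of_bounded (f := fun i => h (i + 1)) (fun i => hh (i + 1)) hd
      (hyk.summable.sub (hsk.summable.mul_left (p k)))).hasSum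
  have s4 := ((s1.add (hsk.mul_left r)).add
    ((((hsk.mul_left (p k)).mul_left (h 1)).add s3).sub s2))
  refine hasSum_le (fun i => ?_) (hyk.mul_left g) s4
  rcases i.eq_zero_or_pos with rfl | hi
  · simp [(hy k).1, hs.eq_zero hy]
  · have e1 := mul_le_mul_of_nonneg_right (hidle i hi) (sub_nonneg.2 (hs k i).2)
    have e2 := mul_le_mul_of_nonneg_right (hsched i hi) (hs k i).1
    linarith

lemma IsRelaxedFeasible.isState (H : Regime p γ α n) {y s : ℕ → Profile}
    (h : IsRelaxedFeasible p γ α y s) (t : ℕ) : IsState γ (y t) := by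
  induction t with
  | zero => exact h.1
  | succ t ih =>
    rw [(h.2.1 t).2]
    exact ih.next (h.2.1 t).1 (fun k => (H.p_pos k).le) (fun k => (H.p_lt_one k).le)

lemma ofReal_truncated_le_meanAge {y : Profile} (hy : IsState γ y) (B : ℕ) :
    ENNReal.ofReal (∑ k, ∑' i, ((min i B : ℕ) : ℝ) * y k i) ≤ meanAge y := by
  have h0 : ∀ k i, 0 ≤ ((min i B : ℕ) : ℝ) * y k i := fun k i =>
    mul_nonneg (Nat.cast_nonneg _) ((hy k).2.1 i)
  rw [meanAge, ENNReal.ofReal_sum_of_nonneg fun k _ => tsum_nonneg (h0 k)]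
  refine Finset.sum_le_sum fun k _ => ?_
  rw [ENNReal.ofReal_tsum_of_nonneg (h0 k) (summable_mul_of_bounded (C := B) (fun i => ?_)
    (hy k).2.1 (hy k).2.2.summable)]
  · refine ENNReal.tsum_le_tsum fun i => ENNReal.ofReal_le_ofReal ?_
    exact mul_le_mul_of_nonneg_right (by exact_mod_cast min_le_left i B) ((hy k).2.1 i)
  · rw [Nat.abs_cast]
    exact_mod_cast min_le_right i B

/-- Lagrangian lower bound for the relaxed problem. -/
theorem IsRelaxedFeasible.le_averageAge (H : Regime p γ α n) {y s : ℕ → Profile}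
    (h : IsRelaxedFeasible p γ α y s) {r : ℝ} (hr : 0 ≤ r) {l : Fin 2 → ℕ} (hl : ∀ k, 1 ≤ l k)
    (hlo : ∀ k i, 1 ≤ i → i < l k → whittleIndex (p k) i ≤ r)
    (hhi : ∀ k, r ≤ whittleIndex (p k) (l k)) :
    ENNReal.ofReal (∑ k, gain (p k) r (l k) * γ k - r * α) ≤ averageAge y := by
  set G := ∑ k, gain (p k) r (l k) * γ k with hG
  have hy := h.isState H
  have hadm := fun t => (h.2.1 t).1
  have hσ1 : ∀ t, ∑ k, scheduled (s t) k ≤ 1 := fun t => by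
    rw [← H.mass_sum, ← Fin.sum_univ_two]
    exact Finset.sum_le_sum fun k _ => scheduled_le (hy t) (hadm t) k
  have hbdd : IsBoundedUnder (· ≤ ·) atTop
      fun T : ℕ => (∑ t ∈ Finset.range T, ∑ k, scheduled (s t) k) / (T : ℝ) := by
    refine isBoundedUnder_of ⟨1, fun T => div_le_one_of_le₀ ?_ (Nat.cast_nonneg _)⟩
    refine (Finset.sum_le_sum fun t _ => hσ1 t).trans ?_
    simp
  have main : ∀ ε : ℝ, 0 < ε → ε ≤ 1 →
      ENNReal.ofReal ((1 - ε) * G - r * (α + ε) - ε) ≤ averageAge y := by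
    intro ε hε hε1
    obtain ⟨B, hBl, hBg, hBε⟩ : ∃ B : ℕ, (∀ k, l k ≤ B) ∧ (∀ k, gain (p k) r (l k) ≤ B) ∧
        ∀ k, 1 / p k ≤ ε * B := by
      have e1 : ∀ᶠ B : ℕ in atTop, ∀ k, l k ≤ B := eventually_all.2 fun k => eventually_ge_atTop _
      have e2 : ∀ᶠ B : ℕ in atTop, ∀ k, gain (p k) r (l k) ≤ B := eventually_all.2 fun k =>
        tendsto_natCast_atTop_atTop.eventually_ge_atTop _
      have e3 : ∀ᶠ B : ℕ in atTop, ∀ k, 1 / p k ≤ ε * B := eventually_all.2 fun k =>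
        (tendsto_natCast_atTop_atTop.const_mul_atTop hε).eventually_ge_atTop _
      exact (e1.and (e2.and e3)).exists
    set b : Fin 2 → ℕ → ℝ := fun k i => (1 - ε) * bias (p k) (gain (p k) r (l k)) (l k) (min i B)
      with hb
    obtain ⟨C, hC⟩ : ∃ C, ∀ k i, |b k i| ≤ C ∧ |((min i B : ℕ) : ℝ)| ≤ C := by
      refine ⟨∑ k, ∑ i ∈ Finset.range (B + 1), |b k i| + B, fun k i => ⟨?_, ?_⟩⟩
      · have e1 : b k i = b k (min i B) := by simp [hb]
        have e2 := Finset.single_le_sum (f := fun i => |b k i|) (fun _ _ => abs_nonneg _)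
          (Finset.mem_range.2 (show min i B < B + 1 by omega))
        have e3 := Finset.single_le_sum (f := fun k => ∑ i ∈ Finset.range (B + 1), |b k i|)
          (fun _ _ => Finset.sum_nonneg fun _ _ => abs_nonneg _) (Finset.mem_univ k)
        have e4 : (0 : ℝ) ≤ B := Nat.cast_nonneg _
        rw [e1]
        exact (e2.trans e3).trans (by linarith)
      · rw [Nat.abs_cast]
        have e1 : ((min i B : ℕ) : ℝ) ≤ B := by exact_mod_cast min_le_right i B
        have e2 : 0 ≤ ∑ k, ∑ i ∈ Finset.range (B + 1), |b k i| :=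
          Finset.sum_nonneg fun _ _ => Finset.sum_nonneg fun _ _ => abs_nonneg _
        linarith
    set F : ℕ → ℝ := fun t => ∑ k, ∑' i, ((min i B : ℕ) : ℝ) * y t k i with hF
    set Φ : ℕ → ℝ := fun t => ∑ k, ∑' i, b k i * y t k i with hΦ
    -- The potential differences telescope, and `|Φ| ≤ C` makes them negligible after division by
    -- `T`. Truncation is what makes `Φ` finite for states of infinite mean age.
    have hstep : ∀ t, (1 - ε) * G ≤ F t + r * ∑ k, scheduled (s t) k + (Φ (t + 1) - Φ t) := by
      intro t
      rw [hG, Finset.mul_sum, hF, hΦ, Finset.mul_sum, ← Finset.sum_sub_distrib,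
        ← Finset.sum_add_distrib, ← Finset.sum_add_distrib]
      refine Finset.sum_le_sum fun k _ => ?_
      rw [← mul_assoc, (h.2.1 t).2]
      have hb1 : b k 1 = 0 := by
        rw [hb]
        simp only
        rw [min_eq_left ((hl k).trans (hBl k)), bias_one _ (hl k), mul_zero]
      have hB := fun {i : ℕ} (hi : 1 ≤ i) => truncated_gain_le (H.p_pos k) (H.p_lt_one k) (hl k) hr
        (hlo k) (hhi k) hε hε1 (hBl k) (hBg k) (hBε k) hi
      refine bellman_le (hy t) (hadm t) (H.p_lt_one k).le (fun i => (hC k i).2)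
        (fun i => (hC k i).1) (fun i hi => (hB hi).1) fun i hi => ?_
      rw [hb1]
      linarith [(hB hi).2]
    have hΦC : ∀ t, |Φ t| ≤ C := fun t => by
      refine (Finset.abs_sum_le_sum_abs _ _).trans ?_
      refine (Finset.sum_le_sum fun k _ => abs_tsum_mul_le (fun i => (hC k i).1) (hy t k).2.1
        (hy t k).2.2).trans_eq ?_
      rw [← Finset.mul_sum, Fin.sum_univ_two, H.mass_sum, mul_one]
    have hsum : ∀ T : ℕ, T * ((1 - ε) * G) ≤ ∑ t ∈ Finset.range T, F t +
        r * ∑ t ∈ Finset.range T, ∑ k, scheduled (s t) k + (Φ T - Φ 0) := by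
      intro T
      induction T with
      | zero => simp
      | succ T ih =>
        rw [Finset.sum_range_succ, Finset.sum_range_succ]
        push_cast
        linarith [hstep T]
    have hevσ := eventually_lt_of_limsup_lt (lt_of_le_of_lt h.2.2 (show α < α + ε by linarith)) hbdd
    have hevT : ∀ᶠ T : ℕ in atTop, 2 * C ≤ ε * T :=
      (tendsto_natCast_atTop_atTop.const_mul_atTop hε).eventually_ge_atTop _
    refine le_limsup_of_frequently_le (Eventually.frequently ?_)
    filter_upwards [hevσ, hevT, eventually_ge_atTop 1] with T hT1 hT2 hT3
    have hT : (0 : ℝ) < T := by exact_mod_cast hT3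
    rw [div_lt_iff₀ hT] at hT1
    have h1 : ((1 - ε) * G - r * (α + ε) - ε) ≤ (∑ t ∈ Finset.range T, F t) / T := by
      rw [le_div_iff₀ hT]
      have e1 := hsum T
      have e2 := mul_le_mul_of_nonneg_left hT1.le hr
      have e3 := abs_le.1 (hΦC T)
      have e4 := abs_le.1 (hΦC 0)
      linarith [e3.1, e3.2, e4.1, e4.2]
    refine (ENNReal.ofReal_le_ofReal h1).trans ?_
    rw [ENNReal.ofReal_div_of_pos hT, ENNReal.ofReal_natCast]
    refine ENNReal.div_le_div_right ?_ _
    rw [ENNReal.ofReal_sum_of_nonneg]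
    · exact Finset.sum_le_sum fun t _ => ofReal_truncated_le_meanAge (hy t) B
    · exact fun t _ => Finset.sum_nonneg fun k _ => tsum_nonneg fun i =>
        mul_nonneg (Nat.cast_nonneg _) ((hy t k).2.1 i)
  have hlim : Tendsto (fun ε : ℝ => ENNReal.ofReal ((1 - ε) * G - r * (α + ε) - ε)) (𝓝[>] 0)
      (𝓝 (ENNReal.ofReal ((1 - 0) * G - r * (α + 0) - 0))) := by
    refine (ENNReal.continuous_ofReal.tendsto _).comp ?_
    refine Tendsto.mono_left (Continuous.tendsto ?_ 0) nhdsWithin_le_nhds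
    fun_prop
  have hev : ∀ᶠ ε : ℝ in 𝓝[>] 0, ENNReal.ofReal ((1 - ε) * G - r * (α + ε) - ε) ≤ averageAge y := by
    filter_upwards [self_mem_nhdsWithin, Ioc_mem_nhdsGT (zero_lt_one (α := ℝ))] with ε h1 h2
    exact main ε h1 h2.2
  have := le_of_tendsto hlim hev
  simpa using this

end LowerBound

section Optimum

variable {p γ : Fin 2 → ℝ} {α : ℝ} {n : ℕ}

lemma averageAge_const (z : Profile) : averageAge (fun _ => z) = meanAge z := by
  have h : (fun T : ℕ => (∑ _t ∈ Finset.range T, meanAge z) / (T : ℝ≥0∞)) =ᶠ[atTop]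
      fun _ => meanAge z := by
    filter_upwards [eventually_ge_atTop 1] with T hT
    rw [Finset.sum_const, Finset.card_range, nsmul_eq_mul, mul_comm]
    exact ENNReal.mul_div_cancel_right (by exact_mod_cast (by omega : T ≠ 0))
      (ENNReal.natCast_ne_top T)
  rw [averageAge, limsup_congr h, limsup_const]

lemma IsFixedPoint.exists_feasible {z : Profile} (h : IsFixedPoint p γ α z) :
    ∃ s : Profile, IsRelaxedFeasible p γ α (fun _ => z) (fun _ => s) := by
  obtain ⟨hz, s, hs, hnext⟩ := h
  refine ⟨s, hz, fun _ => ⟨hs.1, hnext.symm⟩, ?_⟩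
  have h : (fun T : ℕ => (∑ _t ∈ Finset.range T, ∑ k, scheduled s k) / (T : ℝ)) =ᶠ[atTop]
      fun _ => α := by
    filter_upwards [eventually_ge_atTop 1] with T hT
    rw [hs.2.1, Finset.sum_const, Finset.card_range, nsmul_eq_mul]
    exact mul_div_cancel_left₀ _ (by exact_mod_cast (by omega : T ≠ 0))
  rw [limsup_congr h, limsup_const]

/-- At the charge `r` of the tied index, both `l₁` and `l₂` satisfy the optimality conditions. The
mixture uses exactly the budget `α`, so its mean age is the `θ`-combination of the two dual bounds
and cannot exceed the larger one. -/
theorem IsThresholdMixture.isRelaxedOptimum (H : Regime p γ α n) {z : Profile}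
    (h : IsThresholdMixture p γ α z) : IsRelaxedOptimum p γ α z := by
  refine ⟨(h.isFixedPoint H).exists_feasible, fun y s hys => ?_⟩
  have hstate := (h.isFixedPoint H).1
  obtain ⟨m, j, l₁, l₂, θ, hj, hl, h₁, h₂, hθ0, hθ1, hload, hz⟩ := h
  set r := whittleIndex (p m) j with hr
  have hr0 : 0 ≤ r := by
    have := (whittleIndex_strictMono (H.p_pos m)).monotone hj
    rw [whittleIndex_one] at this
    linarith
  have b₁ := hys.le_averageAge H hr0 (fun k => (hl k).1)
    (fun k i hi hil => not_lt.1 fun hlt => (h₁ k i hi).1 hil (Or.inl hlt)) fun k => by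
      have := mt (h₁ k (l₁ k) (hl k).1).2 (lt_irrefl _)
      exact (not_not.1 this).whittleIndex_le
  have b₂ := hys.le_averageAge H hr0 (fun k => (hl k).2)
    (fun k i hi hil => ((h₂ k i hi).1 hil).whittleIndex_le) fun k => not_lt.1 fun hlt =>
      lt_irrefl _ ((h₂ k (l₂ k) (hl k).2).2 (Or.inl hlt))
  rw [averageAge_const]
  have hmean : meanAge z = ENNReal.ofReal
      (θ * (∑ k, gain (p k) r (l₁ k) * γ k - r * α) +
        (1 - θ) * (∑ k, gain (p k) r (l₂ k) * γ k - r * α)) := by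
    have hs : ∀ k, HasSum (fun i : ℕ => i * z k i)
        (γ k * (θ * ((whittleIndex (p k) (l₁ k) + 1 / p k - 1) / (l₁ k * p k + 1 - p k)) +
          (1 - θ) * ((whittleIndex (p k) (l₂ k) + 1 / p k - 1) / (l₂ k * p k + 1 - p k)))) :=
      fun k => HasSum.of_eq
        ((((hasSum_mul_stationaryAge (H.p_pos k) (H.p_lt_one k) (hl k).1).mul_left θ).add
          ((hasSum_mul_stationaryAge (H.p_pos k) (H.p_lt_one k) (hl k).2).mul_left
            (1 - θ))).mul_left (γ k)) (fun i => by rw [hz]; ring) rfl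
    have h0 : ∀ k (i : ℕ), 0 ≤ (i : ℝ) * z k i := fun k i =>
      mul_nonneg (Nat.cast_nonneg _) ((hstate k).2.1 i)
    have e1 : meanAge z = ENNReal.ofReal (∑ k, ∑' i : ℕ, (i : ℝ) * z k i) := by
      rw [ENNReal.ofReal_sum_of_nonneg fun k _ => tsum_nonneg (h0 k), meanAge]
      exact Finset.sum_congr rfl fun k _ =>
        (ENNReal.ofReal_tsum_of_nonneg (h0 k) (hs k).summable).symm
    rw [e1]
    congr 1
    rw [H.thresholdLoad_eq fun k => (hl k).1, H.thresholdLoad_eq fun k => (hl k).2] at hload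
    simp only [fun k => (hs k).tsum_eq, gain]
    have e2 : ∀ x y : ℝ, θ * (x - r * α) + (1 - θ) * (y - r * α) =
        θ * x + (1 - θ) * y - r * α := fun x y => by ring
    rw [e2, ← hload]
    simp only [Fin.sum_univ_two]
    ring
  rw [hmean]
  rcases le_total (∑ k, gain (p k) r (l₁ k) * γ k - r * α)
    (∑ k, gain (p k) r (l₂ k) * γ k - r * α) with hle | hle
  · exact (ENNReal.ofReal_le_ofReal (by nlinarith)).trans b₂
  · exact (ENNReal.ofReal_le_ofReal (by nlinarith)).trans b₁

end Optimum

end AgeFluid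

theorem mainTheorem2 (p γ : Fin 2 → ℝ) (α : ℝ)
    (hp_pos : 0 < p 1) (hp_lt : p 1 < p 0) (hp_one : p 0 < 1)
    (hγ_pos : ∀ k, 0 < γ k) (hγ_sum : γ 0 + γ 1 = 1)
    (hα : 1 / (1 + (AgeFluid.alternationBound p - 2) * p 1) < α) (hα_one : α < 1) :
    ∃ (zstar : AgeFluid.Profile) (αstar : Fin 2 → ℝ),
      (∀ z, AgeFluid.IsThresholdMixture p γ α z ↔ z = zstar) ∧
      AgeFluid.IsRelaxedOptimum p γ α zstar ∧
      (∀ z, AgeFluid.IsFixedPoint p γ α z ↔ z = zstar) ∧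
      αstar 0 + αstar 1 = α ∧
      ∀ z s : ℕ → AgeFluid.Profile, AgeFluid.IsFluidTrajectory p γ α z s →
        ∀ k, Filter.Tendsto (fun t => AgeFluid.scheduled (s t) k) Filter.atTop
            (nhds (αstar k)) ∧
          ∀ i, Filter.Tendsto (fun t => z t k i) Filter.atTop (nhds (zstar k i)) := by
  obtain ⟨hα0, n, hn, hload, halt⟩ := AgeFluid.exists_alternates hp_pos hp_lt hp_one hα hα_one
  have H : AgeFluid.Regime p γ α n :=
    ⟨hp_pos, hp_lt, hp_one, hγ_pos, hγ_sum, hα0, hα_one, hn, hload, halt⟩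
  obtain ⟨zstar, hz⟩ := H.exists_isThresholdMixture
  have hfix := hz.isFixedPoint H
  obtain ⟨hstate, y, hy, hnext⟩ := id hfix
  have htraj := AgeFluid.IsFixedPoint.isFluidTrajectory hstate hy hnext
  refine ⟨zstar, AgeFluid.scheduled y, fun z => ⟨fun h => ?_, fun h => h ▸ hz⟩,
    hz.isRelaxedOptimum H, fun z => ⟨fun h => h.eq H hfix, fun h => h ▸ hfix⟩, ?_,
    fun z s h k => h.tendsto H htraj k⟩
  -- Uniqueness of the mixture is inherited from uniqueness of the fixed point.
  · exact (h.isFixedPoint H).eq H hfix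
  · rw [← Fin.sum_univ_two]
    exact hy.2.1
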